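/- Let $G=(V,E)$ be a finite connected simple graph with at least two vertices and girth at least $6$ (no cycles of length $3,4,5$; trees are allowed). Write $E=\{e_1,\dots,e_n\}$. For a positive weight $\omega:E\to\mathbb R_{>0}$ put $m(x)=\sum_{y\sim x}\omega_{xy}$ and, for $\alpha\in[0,1]$, let $m_x^\alpha$ be the probability measure on $V$ with mass $\alpha$ at $x$ and mass $(1-\alpha)\,\omega_{xy}/m(x)$ at each neighbour $y$ of $x$. The Lin–Lu–Yau curvature of an edge $e=xy$ is $$\kappa_e=\lim_{\alpha\to1^-}\frac1{1-\alpha}\Bigl(1-\frac{W(m_x^\alpha,m_y^\alpha)}{d(x,y)}\Bigr),$$ where $d$ is the combinatorial graph distance and $W$ the associated Wasserstein distance (for girth at least $6$ this equals $2\omega_e(1/m(x)+1/m(y))-2$). With $r_i=\ln\omega_i$ regard $\kappa=(\kappa_1,\dots,\kappa_n)$ as a function of $r\in\mathbb R^n$, let $J=(\partial\kappa_i/\partial r_j)_{i,j}$ (a symmetric positive semi-definite matrix), and let $\bar\kappa=2(|V|/|E|-1)$ be the average curvature. For $g:E\to\mathbb R$ define $$\Delta g_i=-\sum_{j}\frac{\partial\kappa_i}{\partial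 r_j}g_j,\qquad \Delta^s g=-J^s g\quad(s\in\mathbb R),\qquad \Delta_p g_i=\sum_{j\sim i}\Bigl(-\frac{\partial\kappa_i}{\partial r_j}\Bigr)|g_j-g_i|^{p-2}(g_j-g_i)\quad(p>1),$$ where $J^s$ is defined by the spectral decomposition of $J$ with the convention $0^s=0$ for all $s\in\mathbb R$, $j\sim i$ means that the distinct edges $e_i,e_j$ share an endpoint, and terms of $\Delta_p g_i$ with $g_j=g_i$ are $0$. Consider, for $t\ge 0$, the modified Calabi flow $r'=\Delta(\kappa-\bar\kappa)$, the $2s$-th order fractional Calabi flow $r'=\Delta^s(\kappa-\bar\kappa)$, and the $p$-th Calabi flow $r'=\Delta_p(\kappa-\bar\kappa)$, with initial value $r(0)=r_0$. Then for every $r_0\in\mathbb R^n$, for the modified flow, for the fractional flow with any $s\in\mathbb R$, and for the $p$-th flow with any $p>1$: the solution with initial value $r_0$ exists for all times $t\ge0$ and converges as $t\to\infty$ to some $r^*\in\mathbb R^n$ with $\kappa_e(r^*)=\bar\kappa$ for all $e\in E$ (that is, $\omega=e^{r}$ converges to a positive weight of constant curvature $\bar\kappa$) if and only if $$\max_{\emptyset\ne\Omega\subsetneq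 V}\frac{|E(\Omega)|}{|\Omega|}<\frac{|E|}{|V|},$$ where $E(\Omega)$ is the set of edges of the subgraph of $G$ induced by $\Omega$. -/

import Mathlib

open scoped Topology

noncomputable section

namespace CalabiFlow

set_option linter.unusedSectionVars false

variable {V : Type*} [Fintype V] [DecidableEq V] (G : SimpleGraph V) [DecidableRel G.Adj]

/-! ## Weights and Lin-Lu-Yau curvature -/

/-- The weight `ω_{xy}` of the pair `x, y`: the weight of the edge `s(x, y)`, and `0` for
non-adjacent pairs. -/
def pairWeight (ω : G.edgeSet → ℝ) (x y : V) : ℝ :=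
  if h : G.Adj x y then ω ⟨s(x, y), h⟩ else 0

/-- `m(x) = ∑_{y ∼ x} ω_{xy}`. -/
def vertexWeight (ω : G.edgeSet → ℝ) (x : V) : ℝ :=
  ∑ y ∈ G.neighborFinset x, pairWeight G ω x y

/-- The measure `m_x^α`, given by its point masses: `α` at `x`, and `(1 - α) ω_{xy} / m(x)` at each
neighbour `y` of `x`. -/
def walkMeasure (ω : G.edgeSet → ℝ) (α : ℝ) (x y : V) : ℝ :=
  if y = x then α
  else if G.Adj x y then (1 - α) * (pairWeight G ω x y / vertexWeight G ω x)
  else 0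

/-- `ρ : V × V → [0, 1]` is a coupling of `μ` and `ν`. -/
structure IsCoupling (μ ν : V → ℝ) (ρ : V → V → ℝ) : Prop where
  mem_unit : ∀ x y, ρ x y ∈ Set.Icc (0 : ℝ) 1
  fst_marginal : ∀ x, ∑ y, ρ x y = μ x
  snd_marginal : ∀ y, ∑ x, ρ x y = ν y

/-- The Wasserstein distance with respect to the combinatorial graph distance:
`W(μ, ν) = inf_ρ ∑_{x, y} ρ(x, y) d(x, y)` over all couplings `ρ` of `μ` and `ν`. -/
def wasserstein (μ ν : V → ℝ) : ℝ :=
  sInf {c : ℝ | ∃ ρ : V → V → ℝ, IsCoupling μ ν ρ ∧ c = ∑ x, ∑ y, ρ x y * (G.dist x y : ℝ)}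

/-- The Lin-Lu-Yau curvature of a pair of vertices,
`κ(x, y) = lim_{α → 1⁻} (1 - W(m_x^α, m_y^α) / d(x, y)) / (1 - α)`. -/
def pairCurvature (ω : G.edgeSet → ℝ) (x y : V) : ℝ :=
  Filter.limUnder (𝓝[<] (1 : ℝ)) fun α : ℝ =>
    1 / (1 - α) *
      (1 - wasserstein G (walkMeasure G ω α x) (walkMeasure G ω α y) / (G.dist x y : ℝ))

theorem wasserstein_comm (μ ν : V → ℝ) : wasserstein G μ ν = wasserstein G ν μ := by
  have key : ∀ μ ν : V → ℝ,
      {c : ℝ | ∃ ρ : V → V → ℝ, IsCoupling μ ν ρ ∧ c = ∑ x, ∑ y, ρ x y * (G.dist x y : ℝ)} ⊆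
      {c : ℝ | ∃ ρ : V → V → ℝ, IsCoupling ν μ ρ ∧ c = ∑ x, ∑ y, ρ x y * (G.dist x y : ℝ)} := by
    rintro μ ν c ⟨ρ, h, rfl⟩
    refine ⟨fun x y => ρ y x, ⟨fun x y => h.mem_unit y x, h.snd_marginal, h.fst_marginal⟩, ?_⟩
    rw [Finset.sum_comm]
    simp only [G.dist_comm]
  exact congrArg sInf (Set.Subset.antisymm (key μ ν) (key ν μ))

theorem pairCurvature_comm (ω : G.edgeSet → ℝ) (x y : V) :
    pairCurvature G ω x y = pairCurvature G ω y x := by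
  unfold pairCurvature
  simp only [wasserstein_comm G (walkMeasure G ω _ x), G.dist_comm (u := x)]

/-- The curvature `κ_e = κ(x, y)` of the edge `e` with endpoints `x, y`. -/
def edgeCurvature (ω : G.edgeSet → ℝ) (e : G.edgeSet) : ℝ :=
  Sym2.lift ⟨pairCurvature G ω, pairCurvature_comm G ω⟩ (e : Sym2 V)

/-- The weight `ω_i = exp r_i` with logarithmic coordinates `r_i = ln ω_i`. -/
def expWeight (r : G.edgeSet → ℝ) : G.edgeSet → ℝ := fun i => Real.exp (r i)

/-- The curvature vector as a function of `r = ln ω`. -/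
def curvature (r : G.edgeSet → ℝ) : G.edgeSet → ℝ := edgeCurvature G (expWeight G r)

/-- The average curvature `2 (|V| / |E| - 1)`. -/
def averageCurvature : ℝ := 2 * ((Fintype.card V : ℝ) / (G.edgeFinset.card : ℝ) - 1)

/-! ## Discrete Laplace operators -/

/-- The partial derivative `∂κ_i / ∂r_j` at `r`. -/
def partialCurvature (r : G.edgeSet → ℝ) (i j : G.edgeSet) : ℝ :=
  deriv (fun u : ℝ => curvature G (Function.update r j u) i) (r j)

/-- The Jacobian matrix of `κ` with respect to `r`. -/
def jacobian (r : G.edgeSet → ℝ) : Matrix G.edgeSet G.edgeSet ℝ :=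
  Matrix.of fun i j => partialCurvature G r i j

/-- `(Δ g)_i = - ∑_j (∂κ_i / ∂r_j) g_j`. -/
def laplace (r g : G.edgeSet → ℝ) (i : G.edgeSet) : ℝ :=
  -∑ j, partialCurvature G r i j * g j

/-- The real power `x ^ s` of an eigenvalue, with the convention `0 ^ s = 0` for all `s`. -/
def spectralPow (s x : ℝ) : ℝ := if x = 0 then 0 else x ^ s

/-- `Δ^s = - J^s`, where for `J = Qᵀ diag(λ) Q` one has `J^s = Qᵀ diag(λ^s) Q` with `0 ^ s = 0`
(functional calculus of a symmetric matrix). -/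
def fractionalLaplace (s : ℝ) (r g : G.edgeSet → ℝ) (i : G.edgeSet) : ℝ :=
  -((cfc (spectralPow s) (jacobian G r)).mulVec g i)

open Classical in
/-- The discrete `p`-Laplacian
`(Δ_p g)_i = ∑_{j ∼ i} (- ∂κ_i / ∂r_j) |g_j - g_i| ^ (p - 2) (g_j - g_i)`,
where `j ∼ i` means that the distinct edges `i, j` share an endpoint. -/
def pLaplace (p : ℝ) (r g : G.edgeSet → ℝ) (i : G.edgeSet) : ℝ :=
  ∑ j with G.lineGraph.Adj i j, -partialCurvature G r i j * |g j - g i| ^ (p - 2) * (g j - g i)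

/-! ## The Calabi flows with the average curvature as target -/

/-- Right-hand side of the modified Calabi flow `r' = Δ(κ - κ̄)`. -/
def modifiedField (r : G.edgeSet → ℝ) : G.edgeSet → ℝ :=
  laplace G r fun j => curvature G r j - averageCurvature G

/-- Right-hand side of the `2s`-th order fractional Calabi flow `r' = Δ^s(κ - κ̄)`. -/
def fractionalField (s : ℝ) (r : G.edgeSet → ℝ) : G.edgeSet → ℝ :=
  fractionalLaplace G s r fun j => curvature G r j - averageCurvature G

/-- Right-hand side of the `p`-th Calabi flow `r' = Δ_p(κ - κ̄)`. -/
def pField (p : ℝ) (r : G.edgeSet → ℝ) : G.edgeSet → ℝ :=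
  pLaplace G p r fun j => curvature G r j - averageCurvature G

/-- `r` solves `r' = F(r)`, `r(0) = r₀` for all times `t ≥ 0`; the values of `r` at negative
times play no role. -/
def IsGlobalSolution {ι : Type*} [Fintype ι] (F : (ι → ℝ) → ι → ℝ) (r₀ : ι → ℝ)
    (r : ℝ → ι → ℝ) : Prop :=
  r 0 = r₀ ∧ ∀ t, 0 ≤ t → HasDerivWithinAt r (F (r t)) (Set.Ici 0) t

/-- The solution of `r' = F(r)`, `r(0) = r₀` exists for all times and converges, as `t → ∞`, to
(the logarithm of) a positive weight all of whose edge curvatures equal `κ̄`. Uniqueness of the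
solution is not presupposed: every global solution is required to converge to this weight. -/
def ConvergesToConstantCurvature (F : (G.edgeSet → ℝ) → G.edgeSet → ℝ) (r₀ : G.edgeSet → ℝ) :
    Prop :=
  ∃ rStar : G.edgeSet → ℝ, (∀ e, curvature G rStar e = averageCurvature G) ∧
    (∃ r, IsGlobalSolution F r₀ r) ∧
    ∀ r, IsGlobalSolution F r₀ r → Filter.Tendsto r Filter.atTop (𝓝 rStar)

/-! ## The density condition -/

/-- The sets `Ω` with `∅ ≠ Ω ⊊ V`. -/
def properSubsets (V : Type*) [Fintype V] [DecidableEq V] : Finset (Finset V) :=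
  Finset.univ.filter fun Ω => Ω.Nonempty ∧ Ω ⊂ Finset.univ

theorem properSubsets_nonempty (V : Type*) [Fintype V] [DecidableEq V] [Nontrivial V] :
    (properSubsets V).Nonempty := by
  obtain ⟨a, b, hab⟩ := exists_pair_ne V
  refine ⟨{a}, ?_⟩
  simp only [properSubsets, Finset.mem_filter, Finset.mem_univ, true_and]
  refine ⟨Finset.singleton_nonempty a, ?_⟩
  rw [Finset.ssubset_univ_iff]
  intro h
  have : b ∈ ({a} : Finset V) := h ▸ Finset.mem_univ b
  exact hab (Finset.mem_singleton.mp this).symm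

/-- `|E(Ω)| / |Ω|`, where `E(Ω)` is the edge set of the subgraph induced by `Ω`. -/
def density (Ω : Finset V) : ℝ :=
  ((G.induce (Ω : Set V)).edgeSet.ncard : ℝ) / (Ω.card : ℝ)

/-- `max_{∅ ≠ Ω ⊊ V} |E(Ω)| / |Ω|`. -/
def maxDensity [Nontrivial V] : ℝ :=
  (properSubsets V).sup' (properSubsets_nonempty V) (density G)

end CalabiFlow

end

noncomputable section

namespace CalabiFlow

set_option linter.unusedSectionVars false

/-! ## Flows of continuous vector fields -/

/-! Girth at least `6` makes the optimal transport between the endpoints of an edge explicit. The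
curvature of `i` is therefore `2 ∑ v, share r v i - 2`, where at each vertex the shares are the
softmax of `r` over the incident edges (`curvature_eq`). Softmax is the gradient of log-sum-exp, so
with `c = |V| / |E|` the excess curvature is the gradient of `2 (∑ v, log (expSum r v) - c ∑ i, r
i)`. The Jacobian is the Hessian of this potential: its quadratic form is a sum of variances, which
vanishes only on constant vectors (`eq_of_quadraticForm_eq_zero`).

All three flows conserve `∑ i, r i` and decrease the potential, with zero dissipation only where the
excess is constant. Since the excess sums to zero, it then vanishes. `converges_iff` needs nothing
more of a flow than this and continuity.

Necessity: at a weight of constant curvature each edge collects total share `c` and each vertex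
hands out `1`; counting the shares given by `Ω` to the edges inside it yields the density bound,
strict because some edge leaves `Ω` (`density_lt_of_excess_eq_zero`).

Sufficiency: applied to superlevel sets of vertex functions, the density bound makes the potential
control the oscillation of `r` (`layerCake_le`, `exists_sub_le_potential`). Its sublevel sets on the
hyperplanes of fixed sum are thus compact. Critical points there are unique by a maximum principle
(`sub_eq_of_excess_eq`), and a Lyapunov argument drives every solution to the critical point
(`exists_tendsto_of_lyapunov`). The argument uses only continuity of the fields, as the
`p`-Laplacian may fail to be Lipschitz, so solutions come from Peano's theorem after a cutoff. -/

/-- The Euler polygon of step `h`. -/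
def eulerStep {E : Type*} [NormedAddCommGroup E] [NormedSpace ℝ E] (F : E → E) (x₀ : E) (h : ℝ) :
    ℕ → E
  | 0 => x₀
  | k + 1 => eulerStep F x₀ h k + h • F (eulerStep F x₀ h k)

section Peano

variable {E : Type*} [NormedAddCommGroup E] [NormedSpace ℝ E]

theorem norm_eulerStep_sub_le {F : E → E} {C : ℝ} (hC : ∀ x, ‖F x‖ ≤ C) (x₀ : E) {h : ℝ}
    (hh : 0 ≤ h) (k m : ℕ) :
    ‖eulerStep F x₀ h (k + m) - eulerStep F x₀ h k‖ ≤ m * h * C := by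
  induction m with
  | zero => simp
  | succ m ih =>
    have h1 : eulerStep F x₀ h (k + (m + 1)) - eulerStep F x₀ h k =
        (eulerStep F x₀ h (k + m) - eulerStep F x₀ h k) + h • F (eulerStep F x₀ h (k + m)) := by
      rw [← add_assoc, eulerStep]; abel
    rw [h1]
    refine (norm_add_le _ _).trans ?_
    rw [norm_smul, Real.norm_of_nonneg hh]
    have := mul_le_mul_of_nonneg_left (hC (eulerStep F x₀ h (k + m))) hh
    push_cast
    linarith

/-- In a window where the polygon moves by at most `δ`, its velocity varies by at most `ε`. The
bound depends only on the elapsed time `m * h`, so it survives refinement of the step. -/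
theorem norm_eulerStep_sub_sub_le {F : E → E} {C : ℝ} (hC : ∀ x, ‖F x‖ ≤ C) (x₀ : E) {h : ℝ}
    (hh : 0 ≤ h) {δ ε : ℝ} (hF : ∀ x y, ‖x - y‖ ≤ δ → ‖F x - F y‖ ≤ ε) (k m : ℕ)
    (hm : m * h * C ≤ δ) :
    ‖eulerStep F x₀ h (k + m) - eulerStep F x₀ h k - (m * h) • F (eulerStep F x₀ h k)‖
      ≤ m * h * ε := by
  have hC0 : 0 ≤ C := (norm_nonneg _).trans (hC x₀)
  induction m with
  | zero => simp
  | succ m ih =>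
    have hm' : m * h * C ≤ δ := by
      refine le_trans ?_ hm
      push_cast
      nlinarith [mul_nonneg hh hC0]
    have h1 : eulerStep F x₀ h (k + (m + 1)) - eulerStep F x₀ h k
          - (((m + 1 : ℕ) : ℝ) * h) • F (eulerStep F x₀ h k) =
        (eulerStep F x₀ h (k + m) - eulerStep F x₀ h k - (m * h) • F (eulerStep F x₀ h k)) +
          h • (F (eulerStep F x₀ h (k + m)) - F (eulerStep F x₀ h k)) := by
      rw [← add_assoc, eulerStep, smul_sub]; push_cast; rw [add_mul, add_smul, one_mul]; abel
    rw [h1]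
    refine (norm_add_le _ _).trans ?_
    rw [norm_smul, Real.norm_of_nonneg hh]
    have h2 := hF _ _ ((norm_eulerStep_sub_le hC x₀ hh k m).trans hm')
    have := mul_le_mul_of_nonneg_left h2 hh
    have := ih hm'
    push_cast
    linarith

/-- The floor of `t * n`, divided by `n`, tends to `t`. -/
theorem tendsto_floor_mul_div {t : ℝ} (ht : 0 ≤ t) :
    Filter.Tendsto (fun n : ℕ => (⌊t * n⌋₊ : ℝ) * (1 / n)) Filter.atTop (𝓝 t) := by
  have := (tendsto_nat_floor_mul_div_atTop ht).comp (tendsto_natCast_atTop_atTop (R := ℝ))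
  refine this.congr fun n => ?_
  simp [div_eq_mul_inv]

/-- Peano's theorem for bounded uniformly continuous vector fields, with a global solution. -/
theorem exists_globalSolution_of_bounded [ProperSpace E] {F : E → E} (hF : UniformContinuous F)
    {C : ℝ} (hC : ∀ x, ‖F x‖ ≤ C) (x₀ : E) :
    ∃ r : ℝ → E, r 0 = x₀ ∧ ∀ t, 0 ≤ t → HasDerivWithinAt r (F (r t)) (Set.Ici 0) t := by
  have hC0 : 0 ≤ C := (norm_nonneg _).trans (hC x₀)
  -- A free ultrafilter replaces the Arzelà–Ascoli extraction: along it the polygons, confined to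
  -- compact balls, converge at every time simultaneously.
  set l : Filter ℕ := (Filter.hyperfilter ℕ : Filter ℕ) with hl
  have hle : l ≤ Filter.atTop := Nat.hyperfilter_le_atTop
  set e : ℕ → ℝ → E := fun n t => eulerStep F x₀ (1 / n) ⌊t * n⌋₊ with he
  have hlim : ∀ t : ℝ, ∃ x, 0 ≤ t → Filter.Tendsto (fun n => e n t) l (𝓝 x) := by
    intro t
    by_cases ht : 0 ≤ t
    · have hcomp := isCompact_closedBall x₀ (t * C)
      have hmem : ∀ n, e n t ∈ Metric.closedBall x₀ (t * C) := by
        intro n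
        rw [mem_closedBall_iff_norm]
        have h1 := norm_eulerStep_sub_le hC x₀ (h := 1 / (n : ℝ)) (by positivity) 0 ⌊t * n⌋₊
        rw [zero_add] at h1
        refine h1.trans (mul_le_mul_of_nonneg_right ?_ hC0)
        rcases Nat.eq_zero_or_pos n with rfl | hn
        · simpa using ht
        · have hn' : (0 : ℝ) < n := by exact_mod_cast hn
          rw [mul_one_div, div_le_iff₀ hn']
          exact Nat.floor_le (by positivity)
      obtain ⟨x, -, hx⟩ := hcomp.ultrafilter_le_nhds ((Filter.hyperfilter ℕ).map fun n => e n t)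
        (by
          rw [Filter.le_principal_iff]
          exact Filter.mem_map.2 (Filter.univ_mem' hmem))
      exact ⟨x, fun _ => hx⟩
    · exact ⟨x₀, fun h => absurd h ht⟩
  choose r hr using hlim
  -- Forward first-order expansion, with `η` independent of the base point `s`. This uniformity is
  -- what later gives the backward derivative.
  have hloc : ∀ ε > 0, ∃ η > 0, ∀ s t, 0 ≤ s → s ≤ t → t < s + η →
      ‖r t - r s - (t - s) • F (r s)‖ ≤ (t - s) * ε := by
    intro ε hε
    obtain ⟨δ, hδ, hδF⟩ := Metric.uniformContinuous_iff.1 hF ε hε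
    refine ⟨δ / (2 * (C + 1)), by positivity, fun s t hs hst hts => ?_⟩
    have ht : 0 ≤ t := hs.trans hst
    have hF' : ∀ x y, ‖x - y‖ ≤ δ / 2 → ‖F x - F y‖ ≤ ε := fun x y hxy => by
      rw [← dist_eq_norm] at hxy ⊢
      exact (hδF (by linarith)).le
    set a : ℕ → ℝ := fun n => ((⌊t * n⌋₊ - ⌊s * n⌋₊ : ℕ) : ℝ) * (1 / n) with ha
    have hfl : ∀ n : ℕ, ⌊s * n⌋₊ ≤ ⌊t * n⌋₊ := fun n => Nat.floor_le_floor (by gcongr)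
    have halim : Filter.Tendsto a l (𝓝 (t - s)) := by
      have := ((tendsto_floor_mul_div ht).sub (tendsto_floor_mul_div hs)).mono_left hle
      refine this.congr fun n => ?_
      simp only [ha]
      rw [Nat.cast_sub (hfl n), sub_mul]
    have hev : ∀ᶠ n in l, a n * C ≤ δ / 2 := by
      have h1 : t - s < δ / (2 * (C + 1)) := by linarith
      filter_upwards [halim.eventually (gt_mem_nhds h1)] with n hn
      have : δ / (2 * (C + 1)) * C ≤ δ / 2 := by
        rw [div_mul_eq_mul_div, div_le_div_iff₀ (by positivity) (by positivity)]
        nlinarith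
      exact (mul_le_mul_of_nonneg_right hn.le hC0).trans this
    have hFc := (hF.continuous.tendsto (r s)).comp (hr s hs)
    have hlim1 := (((hr t ht).sub (hr s hs)).sub (halim.smul hFc)).norm
    refine le_of_tendsto_of_tendsto hlim1 (halim.mul_const ε) ?_
    filter_upwards [hev] with n hn
    have h1 := norm_eulerStep_sub_sub_le hC x₀ (h := 1 / (n : ℝ)) (by positivity) hF' ⌊s * n⌋₊
      (⌊t * n⌋₊ - ⌊s * n⌋₊) hn
    rw [Nat.add_sub_cancel' (hfl n)] at h1
    exact h1
  have hcont : ∀ ε > 0, ∃ η > 0, ∀ s t, 0 ≤ s → s ≤ t → t < s + η → ‖r t - r s‖ ≤ ε := by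
    intro ε hε
    obtain ⟨η, hη, h⟩ := hloc 1 one_pos
    refine ⟨min η (ε / (C + 1)), by positivity, fun s t hs hst hts => ?_⟩
    have h1 := h s t hs hst (hts.trans_le (by gcongr; exact min_le_left _ _))
    have h2 : t - s ≤ ε / (C + 1) := by
      have := min_le_right η (ε / (C + 1)); linarith
    have h3 : r t - r s = (r t - r s - (t - s) • F (r s)) + (t - s) • F (r s) := by abel
    rw [h3]
    refine (norm_add_le _ _).trans ?_
    rw [norm_smul, Real.norm_of_nonneg (sub_nonneg.2 hst)]
    rw [le_div_iff₀ (by positivity)] at h2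
    have := mul_le_mul_of_nonneg_left (hC (r s)) (sub_nonneg.2 hst)
    linarith
  refine ⟨r, ?_, fun t ht => ?_⟩
  · refine tendsto_nhds_unique (hr 0 le_rfl) ?_
    simp [he, eulerStep]
  · rw [hasDerivWithinAt_iff_isLittleO, Asymptotics.isLittleO_iff]
    intro ε hε
    obtain ⟨η, hη, h⟩ := hloc (ε / 2) (by positivity)
    obtain ⟨δ, hδ, hδF⟩ := Metric.uniformContinuous_iff.1 hF (ε / 2) (by positivity)
    obtain ⟨η', hη', h'⟩ := hcont (δ / 2) (by positivity)
    have hball : Metric.ball t (min η η') ∈ 𝓝[Set.Ici 0] t :=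
      mem_nhdsWithin_of_mem_nhds (Metric.ball_mem_nhds t (by positivity))
    filter_upwards [hball, self_mem_nhdsWithin] with s hs hs0
    rw [Metric.mem_ball, Real.dist_eq, abs_lt] at hs
    have hm1 := min_le_left η η'
    have hm2 := min_le_right η η'
    rcases le_total t s with hts | hst
    · rw [Real.norm_of_nonneg (sub_nonneg.2 hts)]
      refine (h t s ht hts (by linarith)).trans ?_
      nlinarith [sub_nonneg.2 hts]
    · rw [Real.norm_of_nonpos (sub_nonpos.2 hst)]
      have h1 := h s t hs0 hst (by linarith)
      have h2 : ‖F (r t) - F (r s)‖ ≤ ε / 2 := by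
        rw [← dist_eq_norm]
        refine (hδF ?_).le
        rw [dist_eq_norm]
        exact (h' s t hs0 hst (by linarith)).trans_lt (by linarith)
      -- For `s < t` the expansion is based at `s`; continuity of `r` and of `F` then allows `F (r
      -- s)` to be replaced by `F (r t)`.
      have h3 : r s - r t - (s - t) • F (r t) =
          -(r t - r s - (t - s) • F (r s)) + (t - s) • (F (r t) - F (r s)) := by
        rw [smul_sub, ← neg_sub t s, neg_smul]; abel
      rw [h3]
      refine (norm_add_le _ _).trans ?_
      rw [norm_neg, norm_smul, Real.norm_of_nonneg (sub_nonneg.2 hst)]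
      have := mul_le_mul_of_nonneg_left h2 (sub_nonneg.2 hst)
      linarith

end Peano

/-! ## Gradient-like systems -/

section Lyapunov

variable {ι : Type*} [Fintype ι]

/-- `g` is the gradient of `U`, in the form of the chain rule along curves. -/
def HasGradientField (U : (ι → ℝ) → ℝ) (g : (ι → ℝ) → ι → ℝ) : Prop :=
  ∀ (r : ℝ → ι → ℝ) (v : ι → ℝ) (s : Set ℝ) (t : ℝ), HasDerivWithinAt r v s t →
    HasDerivWithinAt (fun t => U (r t)) (∑ i, g (r t) i * v i) s t

theorem antitoneOn_Ici_of_hasDerivWithinAt {f f' : ℝ → ℝ}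
    (hf : ∀ t, 0 ≤ t → HasDerivWithinAt f (f' t) (Set.Ici 0) t) (hf' : ∀ t, 0 ≤ t → f' t ≤ 0) :
    AntitoneOn f (Set.Ici 0) := by
  refine antitoneOn_of_hasDerivWithinAt_nonpos (convex_Ici 0)
    (fun t ht => (hf t ht).continuousWithinAt) (f' := f') (fun t ht => ?_) fun t ht => ?_
  · exact (hf t (interior_subset ht)).mono interior_subset
  · exact hf' t (interior_subset ht)

variable {U : (ι → ℝ) → ℝ} {F g : (ι → ℝ) → ι → ℝ} {r₀ : ι → ℝ} {r : ℝ → ι → ℝ}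

theorem IsGlobalSolution.sum_eq (hr : IsGlobalSolution F r₀ r) (hF : ∀ x, ∑ i, F x i = 0) {t : ℝ}
    (ht : 0 ≤ t) : ∑ i, r t i = ∑ i, r₀ i := by
  have hd : ∀ t, 0 ≤ t → HasDerivWithinAt (fun t => ∑ i, r t i) 0 (Set.Ici 0) t := fun t ht => by
    have := HasDerivWithinAt.fun_sum (u := Finset.univ) fun i _ =>
      (hasDerivWithinAt_pi.1 (hr.2 t ht)) i
    rwa [hF] at this
  have h1 := antitoneOn_Ici_of_hasDerivWithinAt hd (fun _ _ => le_rfl)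
    Set.self_mem_Ici (Set.mem_Ici.2 ht) ht
  have h2 := antitoneOn_Ici_of_hasDerivWithinAt (f' := fun _ => -0) (fun t ht => (hd t ht).neg)
    (fun _ _ => by simp) Set.self_mem_Ici (Set.mem_Ici.2 ht) ht
  simp only [hr.1, Pi.neg_apply] at h1 h2
  linarith

theorem IsGlobalSolution.antitoneOn (hr : IsGlobalSolution F r₀ r) (hU : HasGradientField U g)
    (hF : ∀ x, ∑ i, g x i * F x i ≤ 0) : AntitoneOn (fun t => U (r t)) (Set.Ici 0) :=
  antitoneOn_Ici_of_hasDerivWithinAt (fun t ht => hU r _ _ t (hr.2 t ht)) fun t _ => hF (r t)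

/-- The line through `a` in the direction `g a` stays in the hyperplane of fixed sum, and along it
the derivative of `U` at `a` is the sum of squares of `g a`. -/
theorem eq_zero_of_isMinOn (hU : HasGradientField U g) (hg : ∀ x, ∑ i, g x i = 0) {a : ι → ℝ}
    (ha : ∀ x : ι → ℝ, ∑ i, x i = ∑ i, a i → U a ≤ U x) : g a = 0 := by
  have hline : HasDerivWithinAt (fun t : ℝ => a + t • g a) (g a) Set.univ 0 := by
    refine HasDerivAt.hasDerivWithinAt ?_
    simpa using ((hasDerivAt_id (0 : ℝ)).smul_const (g a)).const_add a
  have hd := hU _ _ _ _ hline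
  rw [hasDerivWithinAt_univ] at hd
  have hmin : IsLocalMin (fun t : ℝ => U (a + t • g a)) 0 := by
    refine Filter.Eventually.of_forall fun t => ?_
    simp only [zero_smul, add_zero]
    refine ha _ ?_
    simp [Finset.sum_add_distrib, ← Finset.mul_sum, hg]
  have h0 := hmin.hasDerivAt_eq_zero hd
  simp only [zero_smul, add_zero] at h0
  rw [Finset.sum_eq_zero_iff_of_nonneg fun i _ => mul_self_nonneg _] at h0
  funext i
  exact mul_self_eq_zero.1 (h0 i (Finset.mem_univ i))

/-- Existence of global solutions for continuous fields preserving the sum of the coordinates and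
having a coercive Lyapunov function. -/
theorem exists_globalSolution (hFc : Continuous F) (hU : HasGradientField U g)
    (hFsum : ∀ x, ∑ i, F x i = 0) (hF : ∀ x, ∑ i, g x i * F x i ≤ 0)
    (hK : ∀ S c : ℝ, IsCompact {x : ι → ℝ | ∑ i, x i = S ∧ U x ≤ c}) (r₀ : ι → ℝ) :
    ∃ r, IsGlobalSolution F r₀ r := by
  obtain ⟨R, hR⟩ := (hK (∑ i, r₀ i) (U r₀)).isBounded.subset_closedBall 0
  -- The cutoff makes the field bounded and uniformly continuous. Being nonnegative it preserves
  -- dissipation, so the solution stays in the sublevel set, where `χ = 1` and the two fields agree.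
  set χ : (ι → ℝ) → ℝ := fun x => max 0 (min 1 (R + 1 - ‖x‖)) with hχ
  have hχc : Continuous χ := by fun_prop
  have hχ0 : ∀ x, 0 ≤ χ x := fun x => le_max_left _ _
  have hχ1 : ∀ x, ‖x‖ ≤ R → χ x = 1 := fun x hx => by
    simp only [hχ]
    rw [min_eq_left (by linarith)]
    simp
  set F' : (ι → ℝ) → ι → ℝ := fun x => χ x • F x with hF'
  have hF'c : Continuous F' := hχc.smul hFc
  have hsupp : HasCompactSupport F' := by
    refine HasCompactSupport.intro (isCompact_closedBall (0 : ι → ℝ) (R + 1)) fun x hx => ?_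
    rw [mem_closedBall_zero_iff, not_le] at hx
    have : χ x = 0 := by
      simp only [hχ]
      exact max_eq_left ((min_le_right _ _).trans (by linarith))
    simp [hF', this]
  obtain ⟨C, hC⟩ := hF'c.bounded_above_of_compact_support hsupp
  obtain ⟨r, hr⟩ := exists_globalSolution_of_bounded
    (hsupp.uniformContinuous_of_continuous hF'c) hC r₀
  have hr' : IsGlobalSolution F' r₀ r := hr
  have hsum : ∀ x, ∑ i, F' x i = 0 := fun x => by
    simp [hF', ← Finset.mul_sum, hFsum]
  have hdiss : ∀ x, ∑ i, g x i * F' x i ≤ 0 := fun x => by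
    have : ∑ i, g x i * F' x i = χ x * ∑ i, g x i * F x i := by
      rw [Finset.mul_sum]
      exact Finset.sum_congr rfl fun i _ => by simp only [hF', Pi.smul_apply, smul_eq_mul]; ring
    rw [this]
    exact mul_nonpos_of_nonneg_of_nonpos (hχ0 x) (hF x)
  refine ⟨r, hr.1, fun t ht => ?_⟩
  have hmem : r t ∈ {x : ι → ℝ | ∑ i, x i = ∑ i, r₀ i ∧ U x ≤ U r₀} := by
    refine ⟨hr'.sum_eq hsum ht, ?_⟩
    have := hr'.antitoneOn hU hdiss Set.self_mem_Ici (Set.mem_Ici.2 ht) ht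
    simpa only [hr.1] using this
  have h1 := hχ1 _ (mem_closedBall_zero_iff.1 (hR hmem))
  have h2 := hr.2 t ht
  simp only [hF', h1, one_smul] at h2
  exact h2

/-- Convergence of gradient-like flows to the unique critical point. -/
theorem exists_tendsto_of_lyapunov (hUc : Continuous U) (hgc : Continuous g) (hFc : Continuous F)
    (hU : HasGradientField U g) (hgsum : ∀ x, ∑ i, g x i = 0) (hFsum : ∀ x, ∑ i, F x i = 0)
    (hF : ∀ x, ∑ i, g x i * F x i ≤ 0) (hF0 : ∀ x, ∑ i, g x i * F x i = 0 → g x = 0)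
    (hK : ∀ S c : ℝ, IsCompact {x : ι → ℝ | ∑ i, x i = S ∧ U x ≤ c})
    (huniq : ∀ a b : ι → ℝ, ∑ i, a i = ∑ i, b i → g a = 0 → g b = 0 → a = b) (r₀ : ι → ℝ) :
    ∃ a, g a = 0 ∧ (∃ r, IsGlobalSolution F r₀ r) ∧
      ∀ r, IsGlobalSolution F r₀ r → Filter.Tendsto r Filter.atTop (𝓝 a) := by
  set K : Set (ι → ℝ) := {x : ι → ℝ | ∑ i, x i = ∑ i, r₀ i ∧ U x ≤ U r₀} with hKdef
  have hKc : IsCompact K := hK _ _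
  have hr₀K : r₀ ∈ K := ⟨rfl, le_rfl⟩
  obtain ⟨a, haK, hamin⟩ := hKc.exists_isMinOn ⟨r₀, hr₀K⟩ hUc.continuousOn
  have hamin' : ∀ x : ι → ℝ, ∑ i, x i = ∑ i, r₀ i → U a ≤ U x := fun x hx => by
    by_cases h : U x ≤ U r₀
    · exact hamin ⟨hx, h⟩
    · exact haK.2.trans (not_le.1 h).le
  have hga : g a = 0 := eq_zero_of_isMinOn hU hgsum fun x hx => hamin' x (hx.trans haK.1)
  -- Another point with the same energy would also be a minimiser, hence critical, contradicting
  -- uniqueness.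
  have hlt : ∀ x ∈ K, x ≠ a → U a < U x := fun x hx hxa => by
    refine lt_of_le_of_ne (hamin' x hx.1) fun h => hxa ?_
    refine huniq _ _ (hx.1.trans haK.1.symm) (eq_zero_of_isMinOn hU hgsum fun y hy => ?_) hga
    rw [← h]
    exact hamin' y (hy.trans hx.1)
  refine ⟨a, hga, exists_globalSolution hFc hU hFsum hF hK r₀, fun r hr => ?_⟩
  have hanti := hr.antitoneOn hU hF
  have hrK : ∀ t, 0 ≤ t → r t ∈ K := fun t ht => by
    refine ⟨hr.sum_eq hFsum ht, ?_⟩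
    have := hanti Set.self_mem_Ici (Set.mem_Ici.2 ht) ht
    simpa only [hr.1] using this
  have hdecay : ∀ m, U a < m → ∃ T, 0 ≤ T ∧ U (r T) < m := by
    intro m hm
    by_contra! hcon
    -- If the energy never fell below `m`, the trajectory would stay in a compact set without
    -- critical points, where the dissipation rate is bounded by some `c < 0`.
    set K' : Set (ι → ℝ) := K ∩ {x | m ≤ U x} with hK'
    have hK'c : IsCompact K' := hKc.inter_right (isClosed_le continuous_const hUc)
    have hDc : Continuous fun x => ∑ i, g x i * F x i := by fun_prop
    obtain ⟨b, hbK, hbmax⟩ := hK'c.exists_isMaxOn ⟨r 0, hrK 0 le_rfl, hcon 0 le_rfl⟩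
      hDc.continuousOn
    have hb : ∑ i, g b i * F b i < 0 := by
      refine lt_of_le_of_ne (hF b) fun h => ?_
      have := huniq b a (hbK.1.1.trans haK.1.symm) (hF0 b h) hga
      have h2 : m ≤ U b := hbK.2
      rw [this] at h2
      linarith
    set c := ∑ i, g b i * F b i with hc
    have hA := antitoneOn_Ici_of_hasDerivWithinAt (f := fun t => U (r t) - c * t)
      (f' := fun t => ∑ i, g (r t) i * F (r t) i - c)
      (fun t ht => by
        have h := ((hasDerivAt_id t).const_mul c).hasDerivWithinAt (s := Set.Ici 0)
        rw [mul_one] at h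
        exact (hU r _ _ t (hr.2 t ht)).fun_sub h)
      (fun t ht => sub_nonpos.2 (hbmax ⟨hrK t ht, hcon t ht⟩))
    -- The linear decay reaches the level `m` at the quotient; one more unit of time gives `U (r T)
    -- ≤ m + c < m`.
    set T := (U (r 0) - m) / (-c) + 1 with hT
    have hT0 : 0 ≤ T := by
      have : 0 ≤ (U (r 0) - m) / (-c) :=
        div_nonneg (sub_nonneg.2 (hcon 0 le_rfl)) (by linarith)
      linarith
    have h1 := hA Set.self_mem_Ici (Set.mem_Ici.2 hT0) hT0
    have h2 := hcon T hT0
    have h3 : -c * T = U (r 0) - m - c := by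
      rw [hT, mul_add, mul_div_cancel₀ _ (by linarith)]; ring
    simp only at h1
    linarith
  refine (nhds_basis_opens a).tendsto_right_iff.2 fun N hN => ?_
  have hKN : IsCompact (K \ N) := hKc.diff hN.2
  rcases (K \ N).eq_empty_or_nonempty with hemp | hne
  · filter_upwards [Filter.eventually_ge_atTop 0] with t ht
    by_contra h
    have : r t ∈ K \ N := ⟨hrK t ht, h⟩
    simp [hemp] at this
  -- On `K \ N` the energy is at least `U b > U a`. Once it has dropped below `U b`, monotonicity
  -- traps the trajectory in `N`.
  · obtain ⟨b, hb, hbmin⟩ := hKN.exists_isMinOn hne hUc.continuousOn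
    obtain ⟨T, hT0, hT⟩ := hdecay (U b) (hlt b hb.1 fun h => hb.2 (h ▸ hN.1))
    filter_upwards [Filter.eventually_ge_atTop T] with t ht
    by_contra h
    have h1 : U b ≤ U (r t) := hbmin ⟨hrK t (hT0.trans ht), h⟩
    have h2 := hanti (Set.mem_Ici.2 hT0) (Set.mem_Ici.2 (hT0.trans ht)) ht
    simp only at h2
    linarith

end Lyapunov

/-! ## Short cycles and distances -/

section Girth

variable {V : Type*} {G : SimpleGraph V}

/-- The girth also bounds the length of every circuit from below, so here and for the longer paths
below only the distinctness of the edges is needed. -/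
theorem not_adj_of_adj_of_adj (hg : 6 ≤ G.egirth) {a b c : V} (hab : G.Adj a b) (hbc : G.Adj b c) :
    ¬ G.Adj c a := by
  intro hca
  have hC : (SimpleGraph.Walk.cons hab (.cons hbc (.cons hca .nil))).IsCircuit := by
    simp [SimpleGraph.Walk.isCircuit_def, SimpleGraph.Walk.isTrail_def, hab.ne, hbc.ne, hca.ne,
      hab.ne', hca.ne']
  have := hg.trans hC.egirth_le_length
  norm_num at this

theorem not_adj_of_path_three (hg : 6 ≤ G.egirth) {a b c d : V} (hab : G.Adj a b) (hbc : G.Adj b c)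
    (hcd : G.Adj c d) (hac : a ≠ c) (hbd : b ≠ d) : ¬ G.Adj d a := by
  intro hda
  have hC : (SimpleGraph.Walk.cons hab (.cons hbc (.cons hcd (.cons hda .nil)))).IsCircuit := by
    simp [SimpleGraph.Walk.isCircuit_def, SimpleGraph.Walk.isTrail_def, hab.ne, hbc.ne, hcd.ne,
      hab.ne', hda.ne, hda.ne', hac, hac.symm, hbd]
  have := hg.trans hC.egirth_le_length
  norm_num at this

theorem not_adj_of_path_four (hg : 6 ≤ G.egirth) {a b c d e : V} (hab : G.Adj a b)
    (hbc : G.Adj b c) (hcd : G.Adj c d) (hde : G.Adj d e) (hac : a ≠ c) (had : a ≠ d) (hbd : b ≠ d)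
    (hbe : b ≠ e) (hce : c ≠ e) : ¬ G.Adj e a := by
  intro hea
  have hC : (SimpleGraph.Walk.cons hab
      (.cons hbc (.cons hcd (.cons hde (.cons hea .nil))))).IsCircuit := by
    simp [SimpleGraph.Walk.isCircuit_def, SimpleGraph.Walk.isTrail_def, hab.ne, hbc.ne, hcd.ne,
      hab.ne', hde.ne, hea.ne, hea.ne', hac, hac.symm, hbd, had, had.symm, hbe, hce]
  have := hg.trans hC.egirth_le_length
  norm_num at this

theorem two_le_dist (hG : G.Connected) {u v : V} (huv : u ≠ v) (h : ¬ G.Adj u v) :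
    2 ≤ G.dist u v := by
  have h0 := hG.pos_dist_of_ne huv
  have h1 : G.dist u v ≠ 1 := fun h' => h (SimpleGraph.dist_eq_one_iff_adj.1 h')
  omega

theorem three_le_dist (hG : G.Connected) {u v : V} (huv : u ≠ v) (h : ¬ G.Adj u v)
    (hc : ∀ c, G.Adj u c → ¬ G.Adj c v) : 3 ≤ G.dist u v := by
  have h2 := two_le_dist hG huv h
  refine Nat.lt_of_le_of_ne h2 fun h' => ?_
  obtain ⟨p, hp⟩ := hG.exists_walk_length_eq_dist u v
  rw [← h'] at hp
  match p, hp with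
  | .cons h1 (.cons h2 .nil), _ => exact hc _ h1 h2

theorem dist_le_two_of_adj_adj {u v w : V} (h1 : G.Adj u v) (h2 : G.Adj v w) : G.dist u w ≤ 2 :=
  SimpleGraph.dist_le (.cons h1 (.cons h2 .nil))

end Girth

/-! ## The curvature of an edge -/

section EdgeCurvature

variable {V : Type*} [Fintype V] [DecidableEq V] (G : SimpleGraph V) [DecidableRel G.Adj]

/-- The transition probability from `x` to `y`. -/
def transition (ω : G.edgeSet → ℝ) (x y : V) : ℝ := pairWeight G ω x y / vertexWeight G ω x

variable {G} {ω : G.edgeSet → ℝ}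

theorem pairWeight_comm (x y : V) : pairWeight G ω x y = pairWeight G ω y x := by
  unfold pairWeight
  by_cases h : G.Adj x y
  · rw [dif_pos h, dif_pos h.symm]
    congr 1
    exact Subtype.ext Sym2.eq_swap
  · rw [dif_neg h, dif_neg fun h' => h h'.symm]

theorem pairWeight_nonneg (hω : ∀ i, 0 < ω i) (x y : V) : 0 ≤ pairWeight G ω x y := by
  unfold pairWeight
  split_ifs
  exacts [(hω _).le, le_rfl]

theorem transition_eq_zero {x y : V} (h : ¬ G.Adj x y) : transition G ω x y = 0 := by
  simp [transition, pairWeight, h]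

theorem vertexWeight_nonneg (hω : ∀ i, 0 < ω i) (x : V) : 0 ≤ vertexWeight G ω x :=
  Finset.sum_nonneg fun _ _ => pairWeight_nonneg hω _ _

theorem vertexWeight_pos (hω : ∀ i, 0 < ω i) {x y : V} (h : G.Adj x y) :
    0 < vertexWeight G ω x := by
  refine Finset.sum_pos' (fun _ _ => pairWeight_nonneg hω _ _) ⟨y, by simpa using h, ?_⟩
  simpa [pairWeight, h] using hω _

theorem transition_nonneg (hω : ∀ i, 0 < ω i) (x y : V) : 0 ≤ transition G ω x y :=
  div_nonneg (pairWeight_nonneg hω _ _) (vertexWeight_nonneg hω _)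

theorem sum_transition (hω : ∀ i, 0 < ω i) {x y : V} (h : G.Adj x y) :
    ∑ z, transition G ω x z = 1 := by
  unfold transition
  rw [← Finset.sum_div, div_eq_one_iff_eq (vertexWeight_pos hω h).ne', vertexWeight,
    SimpleGraph.neighborFinset_eq_filter, Finset.sum_filter]
  refine Finset.sum_congr rfl fun z _ => ?_
  by_cases hz : G.Adj x z <;> simp [pairWeight, hz]

theorem transition_le_one (hω : ∀ i, 0 < ω i) {x y : V} (h : G.Adj x y) (z : V) :
    transition G ω x z ≤ 1 := by
  rw [← sum_transition hω h]
  exact Finset.single_le_sum (fun w _ => transition_nonneg hω x w) (Finset.mem_univ z)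

theorem walkMeasure_eq (α : ℝ) (x u : V) :
    walkMeasure G ω α x u = (if u = x then α else 0) + (1 - α) * transition G ω x u := by
  unfold walkMeasure
  by_cases hux : u = x
  · subst hux
    simp [transition_eq_zero]
  · by_cases h : G.Adj x u
    · simp [hux, h, transition]
    · simp [hux, h, transition_eq_zero]

/-! ### Optimal transport between the endpoints of an edge -/

/-- The optimal coupling of the measures at the endpoints of an edge. -/
def edgeCoupling (G : SimpleGraph V) [DecidableRel G.Adj] (ω : G.edgeSet → ℝ) (α : ℝ)
    (x y u v : V) : ℝ :=
  (if v = y then (1 - α) * transition G ω x u else 0) +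
    (if u = x then (1 - α) * transition G ω y v else 0) +
    (if u = x then if v = y then 2 * α - 1 else 0 else 0)

/-- The neighbours of `x` send their mass to `y`, the neighbours of `y` are fed from `x`, and the
remaining `2 * α - 1` goes from `x` to `y`. Nonnegativity of this remainder is the reason for `1 / 2
≤ α`. -/
theorem isCoupling_edgeCoupling (hω : ∀ i, 0 < ω i) {x y : V} (h : G.Adj x y) {α : ℝ}
    (h₁ : 1 / 2 ≤ α) (h₂ : α ≤ 1) :
    IsCoupling (walkMeasure G ω α x) (walkMeasure G ω α y) (edgeCoupling G ω α x y) := by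
  have hnn : ∀ u v, 0 ≤ edgeCoupling G ω α x y u v := fun u v => by
    have h1 := mul_nonneg (sub_nonneg.2 h₂) (transition_nonneg hω x u)
    have h2 := mul_nonneg (sub_nonneg.2 h₂) (transition_nonneg hω y v)
    unfold edgeCoupling
    split_ifs <;> linarith
  have hfst : ∀ u, ∑ v, edgeCoupling G ω α x y u v = walkMeasure G ω α x u := fun u => by
    unfold edgeCoupling
    rw [walkMeasure_eq, Finset.sum_add_distrib, Finset.sum_add_distrib]
    by_cases hux : u = x
    · simp only [hux, if_true, Finset.sum_ite_eq', Finset.mem_univ, ← Finset.mul_sum,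
        sum_transition hω h.symm]
      ring
    · simp [hux]
  refine ⟨fun u v => ⟨hnn u v, ?_⟩, hfst, fun v => ?_⟩
  · refine (Finset.single_le_sum (fun w _ => hnn u w) (Finset.mem_univ v)).trans ?_
    rw [hfst, walkMeasure_eq]
    have h1 := transition_le_one hω h u
    by_cases hux : u = x
    · simp [hux, transition_eq_zero, h₂]
    · rw [if_neg hux]
      nlinarith [transition_nonneg hω x u]
  · unfold edgeCoupling
    rw [walkMeasure_eq, Finset.sum_add_distrib, Finset.sum_add_distrib]
    by_cases hvy : v = y
    · simp only [hvy, if_true, Finset.sum_ite_eq', Finset.mem_univ, ← Finset.mul_sum,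
        sum_transition hω h]
      ring
    · simp [hvy]

/-- A neighbour of `x` is within distance `2` of `y`, and at distance `0` if it is `y` itself;
symmetrically for `y`. An upper bound suffices because duality supplies the reverse one. -/
theorem edgeCoupling_cost_le (hω : ∀ i, 0 < ω i) {x y : V} (h : G.Adj x y) {α : ℝ}
    (h₂ : α ≤ 1) :
    ∑ u, ∑ v, edgeCoupling G ω α x y u v * (G.dist u v : ℝ) ≤
      1 + (1 - α) * (2 - 2 * (transition G ω x y + transition G ω y x)) := by
  have hd1 : (G.dist x y : ℝ) = 1 := by exact_mod_cast SimpleGraph.dist_eq_one_iff_adj.2 h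
  have hcost : ∑ u, ∑ v, edgeCoupling G ω α x y u v * (G.dist u v : ℝ) =
      (1 - α) * ∑ u, transition G ω x u * G.dist u y +
      (1 - α) * ∑ v, transition G ω y v * G.dist x v + (2 * α - 1) := by
    simp only [edgeCoupling, add_mul, Finset.sum_add_distrib, ite_mul, zero_mul,
      Finset.sum_ite_eq', Finset.mem_univ, if_true, Finset.sum_ite_irrel, Finset.sum_const_zero,
      Finset.mul_sum, mul_assoc, hd1, mul_one]
  have hbound : ∀ {a b : V}, G.Adj a b →
      ∑ u, transition G ω a u * (G.dist u b : ℝ) ≤ 2 - 2 * transition G ω a b := by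
    intro a b hab
    have : ∑ u, transition G ω a u * (2 - if u = b then 2 else 0) =
        2 - 2 * transition G ω a b := by
      simp only [mul_sub, Finset.sum_sub_distrib, ← Finset.sum_mul, sum_transition hω hab, mul_ite,
        mul_zero, Finset.sum_ite_eq', Finset.mem_univ, if_true]
      ring
    rw [← this]
    refine Finset.sum_le_sum fun u _ => ?_
    by_cases hu : G.Adj a u
    · refine mul_le_mul_of_nonneg_left ?_ (transition_nonneg hω _ _)
      by_cases hub : u = b
      · simp [hub]
      · simpa [hub] using (Nat.cast_le (α := ℝ)).2 (dist_le_two_of_adj_adj hu.symm hab)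
    · simp [transition_eq_zero hu]
  have h1 := mul_le_mul_of_nonneg_left (hbound h) (sub_nonneg.2 h₂)
  have h2 := mul_le_mul_of_nonneg_left (hbound h.symm) (sub_nonneg.2 h₂)
  simp only [G.dist_comm (v := x)] at h2
  rw [hcost]
  linarith

/-- The Kantorovich potential of an edge. -/
def edgePotential (G : SimpleGraph V) [DecidableRel G.Adj] (x y u : V) : ℝ :=
  if u = x then 1 else if u = y then 0 else if G.Adj x u then 2 else -1

/-- The potential takes the values `2, 1, 0, -1` along a path `u, x, y, v`. The extreme case needs
`3 ≤ G.dist u v`, where cycles of length four and five are excluded; triangles are excluded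
throughout. -/
theorem edgePotential_sub_le_dist (hG : G.Connected) (hg : 6 ≤ G.egirth) {x y u v : V}
    (h : G.Adj x y) (hu : u = x ∨ G.Adj x u) (hv : v = y ∨ G.Adj y v) :
    edgePotential G x y u - edgePotential G x y v ≤ G.dist u v := by
  have hpx : edgePotential G x y x = 1 := by simp [edgePotential]
  have hpy : edgePotential G x y y = 0 := by simp [edgePotential, h.ne']
  have hpz : ∀ {z}, G.Adj x z → z ≠ y → edgePotential G x y z = 2 := fun hz hzy => by
    simp [edgePotential, hz.ne', hzy, hz]
  have hpw : ∀ {w}, G.Adj y w → w ≠ x → edgePotential G x y w = -1 := fun {w} hw hwx => by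
    have : ¬ G.Adj x w := fun h' => not_adj_of_adj_of_adj hg h hw h'.symm
    simp [edgePotential, hwx, hw.ne', this]
  have hd1 : ∀ {a b : V}, a ≠ b → (1 : ℝ) ≤ G.dist a b := fun hab => by
    exact_mod_cast hG.pos_dist_of_ne hab
  have hd2 : ∀ {a b : V}, a ≠ b → ¬ G.Adj a b → (2 : ℝ) ≤ G.dist a b := fun hab hn => by
    exact_mod_cast two_le_dist hG hab hn
  by_cases hux : u = x
  · subst hux
    by_cases hvu : v = u
    · simp [hvu]
    rcases hv with rfl | hv
    · rw [hpx, hpy]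
      linarith [hd1 h.ne]
    · rw [hpx, hpw hv hvu]
      linarith [hd2 (Ne.symm hvu) fun h' => not_adj_of_adj_of_adj hg h hv h'.symm]
  have hxu := hu.resolve_left hux
  by_cases huy : u = y
  · subst huy
    by_cases hvu : v = u
    · simp [hvu]
    have hv' := hv.resolve_left hvu
    by_cases hvx : v = x
    · subst hvx
      rw [hpy, hpx]
      linarith [hd1 h.ne']
    · rw [hpy, hpw hv' hvx]
      linarith [hd1 hv'.ne]
  rw [hpz hxu huy]
  have huy' : ¬ G.Adj u y := fun h' => not_adj_of_adj_of_adj hg hxu h' h.symm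
  rcases hv with rfl | hv
  · rw [hpy]
    linarith [hd2 huy huy']
  by_cases hvx : v = x
  · subst hvx
    rw [hpx]
    linarith [hd1 hux]
  · rw [hpw hv hvx]
    have hxv : ¬ G.Adj x v := fun h' => not_adj_of_adj_of_adj hg h hv h'.symm
    have huv : u ≠ v := fun h' => huy' (h' ▸ hv.symm)
    have h3 : (3 : ℝ) ≤ G.dist u v := by
      exact_mod_cast three_le_dist hG huv
        (fun h' => not_adj_of_path_three hg hxu h' hv.symm (Ne.symm hvx) huy h.symm)
        (fun c hc hcv => not_adj_of_path_four hg hxu hc hcv hv.symm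
          (fun h' => hxv (h' ▸ hcv)) (Ne.symm hvx) huv huy (fun h' => huy' (h' ▸ hc)) h.symm)
    linarith

/-- Kantorovich duality in its easy direction. The Lipschitz bound is needed only on the supports of
the two measures, since a coupling vanishes elsewhere. -/
theorem le_coupling_cost (hG : G.Connected) (hg : 6 ≤ G.egirth) (hω : ∀ i, 0 < ω i) {x y : V}
    (h : G.Adj x y) {α : ℝ} {ρ : V → V → ℝ}
    (hρ : IsCoupling (walkMeasure G ω α x) (walkMeasure G ω α y) ρ) :
    1 + (1 - α) * (2 - 2 * (transition G ω x y + transition G ω y x)) ≤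
      ∑ u, ∑ v, ρ u v * (G.dist u v : ℝ) := by
  have hsupp : ∀ {z u : V}, walkMeasure G ω α z u ≠ 0 → u = z ∨ G.Adj z u := by
    intro z u hu
    by_contra! hcon
    simp [walkMeasure, hcon.1, hcon.2] at hu
  have h1 : ∑ u, ∑ v, ρ u v * (edgePotential G x y u - edgePotential G x y v) ≤
      ∑ u, ∑ v, ρ u v * (G.dist u v : ℝ) := by
    refine Finset.sum_le_sum fun u _ => Finset.sum_le_sum fun v _ => ?_
    by_cases hu : walkMeasure G ω α x u = 0
    · rw [← hρ.fst_marginal, Finset.sum_eq_zero_iff_of_nonneg fun v _ => (hρ.mem_unit u v).1] at hu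
      simp [hu v (Finset.mem_univ v)]
    by_cases hv : walkMeasure G ω α y v = 0
    · rw [← hρ.snd_marginal, Finset.sum_eq_zero_iff_of_nonneg fun u _ => (hρ.mem_unit u v).1] at hv
      simp [hv u (Finset.mem_univ u)]
    exact mul_le_mul_of_nonneg_left (edgePotential_sub_le_dist hG hg h (hsupp hu) (hsupp hv))
      (hρ.mem_unit u v).1
  refine le_trans (le_of_eq ?_) h1
  have h2 : ∑ u, ∑ v, ρ u v * (edgePotential G x y u - edgePotential G x y v) =
      ∑ u, walkMeasure G ω α x u * edgePotential G x y u -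
        ∑ v, walkMeasure G ω α y v * edgePotential G x y v := by
    simp only [mul_sub, Finset.sum_sub_distrib]
    congr 1
    · simp only [← Finset.sum_mul, hρ.fst_marginal]
    · rw [Finset.sum_comm]
      simp only [← Finset.sum_mul, hρ.snd_marginal]
  have hx : ∑ u, transition G ω x u * edgePotential G x y u = 2 - 2 * transition G ω x y := by
    have : ∀ u, transition G ω x u * edgePotential G x y u =
        transition G ω x u * 2 - if u = y then 2 * transition G ω x y else 0 := by
      intro u
      by_cases hu : G.Adj x u
      · by_cases huy : u = y
        · simp [edgePotential, huy, h.ne', mul_comm]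
        · simp [edgePotential, huy, hu.ne', hu]
      · have : u ≠ y := fun h' => hu (h' ▸ h)
        simp [transition_eq_zero hu, this]
    simp only [this, Finset.sum_sub_distrib, ← Finset.sum_mul, sum_transition hω h,
      Finset.sum_ite_eq', Finset.mem_univ, if_true, one_mul]
  have hy : ∑ v, transition G ω y v * edgePotential G x y v = 2 * transition G ω y x - 1 := by
    have : ∀ v, transition G ω y v * edgePotential G x y v =
        (if v = x then 2 * transition G ω y x else 0) - transition G ω y v := by
      intro v
      by_cases hv : G.Adj y v
      · by_cases hvx : v = x
        · simp [edgePotential, hvx]; ring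
        · have : ¬ G.Adj x v := fun h' => not_adj_of_adj_of_adj hg h hv h'.symm
          simp [edgePotential, hvx, hv.ne', this]
      · have : v ≠ x := fun h' => hv (h' ▸ h.symm)
        simp [transition_eq_zero hv, this]
    simp only [this, Finset.sum_sub_distrib, sum_transition hω h.symm,
      Finset.sum_ite_eq', Finset.mem_univ, if_true]
  have hpx : edgePotential G x y x = 1 := by simp [edgePotential]
  have hpy : edgePotential G x y y = 0 := by simp [edgePotential, h.ne']
  rw [h2]
  simp only [walkMeasure_eq, add_mul, Finset.sum_add_distrib, mul_assoc, ← Finset.mul_sum, hx, hy,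
    ite_mul, zero_mul, Finset.sum_ite_eq', Finset.mem_univ, if_true, hpx, hpy]
  ring

theorem wasserstein_walkMeasure (hG : G.Connected) (hg : 6 ≤ G.egirth) (hω : ∀ i, 0 < ω i) {x y : V}
    (h : G.Adj x y) {α : ℝ} (h₁ : 1 / 2 ≤ α) (h₂ : α ≤ 1) :
    wasserstein G (walkMeasure G ω α x) (walkMeasure G ω α y) =
      1 + (1 - α) * (2 - 2 * (transition G ω x y + transition G ω y x)) := by
  have hc := isCoupling_edgeCoupling hω h h₁ h₂
  refine IsLeast.csInf_eq ⟨⟨_, hc, ?_⟩, ?_⟩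
  · exact le_antisymm (le_coupling_cost hG hg hω h hc) (edgeCoupling_cost_le hω h h₂)
  · rintro c ⟨ρ, hρ, rfl⟩
    exact le_coupling_cost hG hg hω h hρ

/-- For `α` in `(1/2, 1)` the distance is affine in `1 - α`, so the quotient defining the curvature
is constant near `1`. -/
theorem pairCurvature_eq (hG : G.Connected) (hg : 6 ≤ G.egirth) (hω : ∀ i, 0 < ω i) {x y : V}
    (h : G.Adj x y) :
    pairCurvature G ω x y = 2 * (transition G ω x y + transition G ω y x) - 2 := by
  refine Filter.Tendsto.limUnder_eq (tendsto_const_nhds.congr' ?_)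
  have hmem : Set.Ioo (1 / 2 : ℝ) 1 ∈ 𝓝[<] (1 : ℝ) := Ioo_mem_nhdsLT (by norm_num)
  filter_upwards [hmem] with α hα
  have hd1 : (G.dist x y : ℝ) = 1 := by exact_mod_cast SimpleGraph.dist_eq_one_iff_adj.2 h
  rw [wasserstein_walkMeasure hG hg hω h hα.1.le hα.2.le, hd1, div_one]
  have : 1 - α ≠ 0 := (sub_pos.2 hα.2).ne'
  field_simp
  ring

end EdgeCurvature

/-! ## Edge shares and the Jacobian of the curvature -/

section Shares

variable {V : Type*} [Fintype V] [DecidableEq V] {G : SimpleGraph V} [DecidableRel G.Adj]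

/-- The total weight of the edges at `v`. -/
def expSum (r : G.edgeSet → ℝ) (v : V) : ℝ :=
  ∑ i : G.edgeSet, if v ∈ (i : Sym2 V) then Real.exp (r i) else 0

/-- The share of the edge `i` in the total weight at `v`. -/
def share (r : G.edgeSet → ℝ) (v : V) (i : G.edgeSet) : ℝ :=
  if v ∈ (i : Sym2 V) then Real.exp (r i) / expSum r v else 0

theorem vertexWeight_expWeight (r : G.edgeSet → ℝ) (v : V) :
    vertexWeight G (expWeight G r) v = expSum r v := by
  unfold vertexWeight expSum
  rw [← Finset.sum_filter]
  refine Finset.sum_bij (fun y hy => (⟨s(v, y), (G.mem_neighborFinset v y).1 hy⟩ : G.edgeSet))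
    (fun y hy => by simp) (fun y _ z _ h => ?_) (fun i hi => ?_) (fun y hy => ?_)
  · exact Sym2.congr_right.1 (congrArg Subtype.val h)
  · obtain ⟨e, he⟩ := i
    obtain ⟨y, rfl⟩ := (Finset.mem_filter.1 hi).2
    exact ⟨y, (G.mem_neighborFinset v y).2 he, rfl⟩
  · have : G.Adj v y := (G.mem_neighborFinset v y).1 hy
    simp [pairWeight, this, expWeight]

theorem sum_ite_mem_edge {x y : V} (h : x ≠ y) (f : V → ℝ) :
    ∑ v, (if v ∈ s(x, y) then f v else 0) = f x + f y := by
  rw [← Finset.sum_filter, ← Finset.sum_pair h]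
  refine Finset.sum_congr ?_ fun _ _ => rfl
  ext v
  simp

theorem curvature_eq (hG : G.Connected) (hg : 6 ≤ G.egirth) (r : G.edgeSet → ℝ) (i : G.edgeSet) :
    curvature G r i = 2 * ∑ v, share r v i - 2 := by
  obtain ⟨e, he⟩ := i
  induction e with
  | _ x y =>
    have hxy : G.Adj x y := he
    have hω : ∀ i, 0 < expWeight G r i := fun i => Real.exp_pos _
    have h1 : curvature G r ⟨s(x, y), he⟩ = pairCurvature G (expWeight G r) x y := rfl
    have h2 : pairWeight G (expWeight G r) x y = Real.exp (r ⟨s(x, y), he⟩) := by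
      simp [pairWeight, hxy, expWeight]
    rw [h1, pairCurvature_eq hG hg hω hxy]
    unfold share transition
    rw [pairWeight_comm y x, h2, vertexWeight_expWeight, vertexWeight_expWeight,
      sum_ite_mem_edge hxy.ne]

theorem exists_edge_mem [Nontrivial V] (hG : G.Connected) (v : V) :
    ∃ i : G.edgeSet, v ∈ (i : Sym2 V) := by
  obtain ⟨w, hw⟩ := exists_ne v
  obtain ⟨p⟩ := hG.preconnected v w
  match p with
  | .nil => exact absurd rfl hw
  | .cons h _ => exact ⟨⟨s(v, _), h⟩, by simp⟩

theorem expSum_pos_of_mem (r : G.edgeSet → ℝ) {v : V} {i : G.edgeSet} (hi : v ∈ (i : Sym2 V)) :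
    0 < expSum r v := by
  refine Finset.sum_pos' (fun j _ => ?_) ⟨i, Finset.mem_univ _, ?_⟩
  · split_ifs
    exacts [(Real.exp_pos _).le, le_rfl]
  · rw [if_pos hi]
    exact Real.exp_pos _

theorem expSum_pos [Nontrivial V] (hG : G.Connected) (r : G.edgeSet → ℝ) (v : V) :
    0 < expSum r v :=
  (exists_edge_mem hG v).elim fun _ hi => expSum_pos_of_mem r hi

theorem share_pos (r : G.edgeSet → ℝ) {v : V} {i : G.edgeSet} (hi : v ∈ (i : Sym2 V)) :
    0 < share r v i := by
  rw [share, if_pos hi]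
  exact div_pos (Real.exp_pos _) (expSum_pos_of_mem r hi)

theorem share_of_notMem (r : G.edgeSet → ℝ) {v : V} {i : G.edgeSet} (hi : v ∉ (i : Sym2 V)) :
    share r v i = 0 := if_neg hi

theorem share_nonneg (r : G.edgeSet → ℝ) (v : V) (i : G.edgeSet) : 0 ≤ share r v i := by
  by_cases hi : v ∈ (i : Sym2 V)
  · exact (share_pos r hi).le
  · exact (share_of_notMem r hi).ge

theorem sum_share [Nontrivial V] (hG : G.Connected) (r : G.edgeSet → ℝ) (v : V) :
    ∑ i, share r v i = 1 := by
  have h : ∀ i : G.edgeSet, share r v i =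
      (if v ∈ (i : Sym2 V) then Real.exp (r i) else 0) / expSum r v := fun i => by
    unfold share; split_ifs <;> simp
  simp only [h, ← Finset.sum_div]
  exact div_self (expSum_pos hG r v).ne'

theorem continuous_share (v : V) (i : G.edgeSet) : Continuous fun r => share r v i := by
  by_cases hi : v ∈ (i : Sym2 V)
  · simp only [share, if_pos hi]
    refine Continuous.div (by fun_prop) ?_ fun r => (expSum_pos_of_mem r hi).ne'
    refine continuous_finsetSum _ fun j _ => ?_
    split_ifs <;> fun_prop
  · simp only [share, if_neg hi]
    exact continuous_const

/-- A property of edges that passes to edges sharing an endpoint holds for all edges. -/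
theorem edge_induction (hG : G.Connected) {P : G.edgeSet → Prop}
    (hP : ∀ (v : V) (i j : G.edgeSet), v ∈ (i : Sym2 V) → v ∈ (j : Sym2 V) → P i → P j)
    {i : G.edgeSet} (hi : P i) (j : G.edgeSet) : P j := by
  have key : ∀ {v w : V} (_ : G.Walk v w) (i j : G.edgeSet), v ∈ (i : Sym2 V) →
      w ∈ (j : Sym2 V) → P i → P j := by
    intro v w p
    induction p with
    | nil => exact fun i j hvi hvj => hP _ i j hvi hvj
    | cons h p ih =>
      intro i j hvi hwj hi
      exact ih ⟨s(_, _), h⟩ j (by simp) hwj (hP _ i ⟨s(_, _), h⟩ hvi (by simp) hi)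
  have hmem : ∀ k : G.edgeSet, ∃ v, v ∈ (k : Sym2 V) := fun k => ⟨_, Sym2.out_fst_mem _⟩
  obtain ⟨v, hv⟩ := hmem i
  obtain ⟨w, hw⟩ := hmem j
  obtain ⟨p⟩ := hG.preconnected v w
  exact key p i j hv hw hi

theorem eq_of_forall_eq_at_vertex (hG : G.Connected) {f : G.edgeSet → ℝ}
    (hf : ∀ (v : V) (i j : G.edgeSet), v ∈ (i : Sym2 V) → v ∈ (j : Sym2 V) → f i = f j)
    (i j : G.edgeSet) : f i = f j :=
  edge_induction hG (P := fun k => f i = f k) (fun v k l hk hl h => h.trans (hf v k l hk hl)) rfl j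

/-! ### Derivatives of the shares and the Jacobian -/

theorem hasDerivAt_exp_update (r : G.edgeSet → ℝ) (j i : G.edgeSet) :
    HasDerivAt (fun u : ℝ => Real.exp (Function.update r j u i))
      (if i = j then Real.exp (r i) else 0) (r j) := by
  by_cases hij : i = j
  · subst hij
    simpa using Real.hasDerivAt_exp (r i)
  · simpa [hij] using hasDerivAt_const (r j) (Real.exp (r i))

theorem hasDerivAt_expSum_update (r : G.edgeSet → ℝ) (j : G.edgeSet) (v : V) :
    HasDerivAt (fun u : ℝ => expSum (Function.update r j u) v)
      (if v ∈ (j : Sym2 V) then Real.exp (r j) else 0) (r j) := by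
  have h : ∀ i ∈ (Finset.univ : Finset G.edgeSet), HasDerivAt
      (fun u : ℝ => if v ∈ (i : Sym2 V) then Real.exp (Function.update r j u i) else 0)
      (if i = j then (if v ∈ (j : Sym2 V) then Real.exp (r j) else 0) else 0) (r j) := by
    intro i _
    have := hasDerivAt_exp_update r j i
    by_cases hi : v ∈ (i : Sym2 V)
    · simp only [hi, if_true]
      convert! this using 1
      by_cases hij : i = j
      · subst hij; simp [hi]
      · simp [hij]
    · simp only [hi, if_false]
      convert! hasDerivAt_const (r j) (0 : ℝ) using 1
      by_cases hij : i = j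
      · subst hij; simp [hi]
      · simp [hij]
  have := HasDerivAt.fun_sum h
  simpa using! this

/-- The softmax derivative `p i * (δ i j - p j)`; for edges not incident to `v` both sides vanish.
-/
theorem hasDerivAt_share_update (r : G.edgeSet → ℝ) (j i : G.edgeSet) (v : V) :
    HasDerivAt (fun u : ℝ => share (Function.update r j u) v i)
      (share r v i * ((if i = j then 1 else 0) - share r v j)) (r j) := by
  by_cases hi : v ∈ (i : Sym2 V)
  · simp only [share, if_pos hi]
    have hS := expSum_pos_of_mem r hi
    have h := (hasDerivAt_exp_update r j i).div (hasDerivAt_expSum_update r j v)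
      (by simpa using hS.ne')
    simp only [Function.update_eq_self] at h
    convert! h using 1
    by_cases hij : i = j
    · subst hij
      simp only [if_true, hi]
      field_simp
    · by_cases hj : v ∈ (j : Sym2 V)
      · simp only [hij, hj, if_true, if_false]
        field_simp
        ring
      · simp [hij, hj]
  · simp only [share, if_neg hi, zero_mul]
    exact hasDerivAt_const _ _

theorem partialCurvature_eq (hG : G.Connected) (hg : 6 ≤ G.egirth) (r : G.edgeSet → ℝ)
    (i j : G.edgeSet) :
    partialCurvature G r i j =
      2 * ∑ v, share r v i * ((if i = j then 1 else 0) - share r v j) := by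
  unfold partialCurvature
  simp only [curvature_eq hG hg]
  exact (((HasDerivAt.fun_sum fun v _ => hasDerivAt_share_update r j i v).const_mul 2).sub_const
    2).deriv

theorem partialCurvature_comm (hG : G.Connected) (hg : 6 ≤ G.egirth) (r : G.edgeSet → ℝ)
    (i j : G.edgeSet) : partialCurvature G r i j = partialCurvature G r j i := by
  rw [partialCurvature_eq hG hg, partialCurvature_eq hG hg]
  congr 1
  refine Finset.sum_congr rfl fun v _ => ?_
  by_cases hij : i = j
  · subst hij; rfl
  · rw [if_neg hij, if_neg (Ne.symm hij)]; ring

theorem sum_partialCurvature [Nontrivial V] (hG : G.Connected) (hg : 6 ≤ G.egirth)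
    (r : G.edgeSet → ℝ) (i : G.edgeSet) : ∑ j, partialCurvature G r i j = 0 := by
  simp only [partialCurvature_eq hG hg, ← Finset.mul_sum]
  rw [Finset.sum_comm]
  simp [← Finset.mul_sum, Finset.sum_sub_distrib, sum_share hG]

theorem partialCurvature_neg (hG : G.Connected) (hg : 6 ≤ G.egirth) (r : G.edgeSet → ℝ)
    {i j : G.edgeSet} (hij : G.lineGraph.Adj i j) : partialCurvature G r i j < 0 := by
  obtain ⟨hne, v, hvi, hvj⟩ := SimpleGraph.lineGraph_adj_iff_exists.1 hij
  rw [partialCurvature_eq hG hg]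
  have : ∑ v, share r v i * ((if i = j then 1 else 0) - share r v j) < 0 := by
    refine Finset.sum_neg' (fun w _ => ?_) ⟨v, Finset.mem_univ v, ?_⟩
    · rw [if_neg hne, zero_sub, mul_neg, neg_nonpos]
      exact mul_nonneg (share_nonneg r w i) (share_nonneg r w j)
    · rw [if_neg hne, zero_sub, mul_neg, neg_lt_zero]
      exact mul_pos (share_pos r hvi) (share_pos r hvj)
  linarith

theorem continuous_partialCurvature (hG : G.Connected) (hg : 6 ≤ G.egirth) (i j : G.edgeSet) :
    Continuous fun r => partialCurvature G r i j := by
  simp only [partialCurvature_eq hG hg]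
  refine continuous_const.mul (continuous_finsetSum _ fun v _ => ?_)
  exact (continuous_share v i).mul (continuous_const.sub (continuous_share v j))

theorem continuous_curvature (hG : G.Connected) (hg : 6 ≤ G.egirth) (i : G.edgeSet) :
    Continuous fun r => curvature G r i := by
  simp only [curvature_eq hG hg]
  exact (continuous_const.mul (continuous_finsetSum _ fun v _ => continuous_share v i)).sub
    continuous_const

/-- The quadratic form of the Jacobian is twice the sum of the variances of `f` at the vertices. -/
theorem quadraticForm_partialCurvature [Nontrivial V] (hG : G.Connected) (hg : 6 ≤ G.egirth)
    (r f : G.edgeSet → ℝ) :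
    ∑ i, f i * ∑ j, partialCurvature G r i j * f j =
      2 * ∑ v, ∑ i, share r v i * (f i - ∑ j, share r v j * f j) ^ 2 := by
  have h1 : ∀ v, ∑ i, share r v i * (f i - ∑ j, share r v j * f j) ^ 2 =
      ∑ i, share r v i * f i ^ 2 - (∑ j, share r v j * f j) ^ 2 := by
    intro v
    set m := ∑ j, share r v j * f j with hm
    have : ∀ i, share r v i * (f i - m) ^ 2 =
        share r v i * f i ^ 2 - 2 * m * (share r v i * f i) + share r v i * m ^ 2 :=
      fun i => by ring
    simp only [this, Finset.sum_add_distrib, Finset.sum_sub_distrib, ← Finset.mul_sum,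
      ← Finset.sum_mul, sum_share hG, ← hm]
    ring
  have h2 : ∀ i, ∑ j, partialCurvature G r i j * f j =
      2 * ∑ v, share r v i * (f i - ∑ j, share r v j * f j) := by
    intro i
    simp only [partialCurvature_eq hG hg, mul_assoc, Finset.sum_mul, ← Finset.mul_sum]
    rw [Finset.sum_comm]
    simp only [← Finset.mul_sum, sub_mul, Finset.sum_sub_distrib, ite_mul, one_mul, zero_mul,
      Finset.sum_ite_eq, Finset.mem_univ, if_true]
  simp only [h1, h2]
  have h3 : ∀ i, f i * (2 * ∑ v, share r v i * (f i - ∑ j, share r v j * f j)) =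
      2 * ∑ v, (share r v i * f i ^ 2 - share r v i * f i * ∑ j, share r v j * f j) := by
    intro i
    rw [mul_left_comm, Finset.mul_sum]
    congr 1
    exact Finset.sum_congr rfl fun v _ => by ring
  simp only [h3, ← Finset.mul_sum]
  rw [Finset.sum_comm]
  simp only [Finset.sum_sub_distrib, ← Finset.sum_mul, sq]

theorem quadraticForm_nonneg [Nontrivial V] (hG : G.Connected) (hg : 6 ≤ G.egirth)
    (r f : G.edgeSet → ℝ) : 0 ≤ ∑ i, f i * ∑ j, partialCurvature G r i j * f j := by
  rw [quadraticForm_partialCurvature hG hg]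
  exact mul_nonneg zero_le_two (Finset.sum_nonneg fun v _ => Finset.sum_nonneg fun i _ =>
    mul_nonneg (share_nonneg r v i) (sq_nonneg _))

/-- Each variance vanishes and the shares of incident edges are positive, so `f` is constant around
every vertex; connectedness makes it globally constant. -/
theorem eq_of_quadraticForm_eq_zero [Nontrivial V] (hG : G.Connected) (hg : 6 ≤ G.egirth)
    {r f : G.edgeSet → ℝ} (h : ∑ i, f i * ∑ j, partialCurvature G r i j * f j = 0)
    (i j : G.edgeSet) : f i = f j := by
  rw [quadraticForm_partialCurvature hG hg, mul_eq_zero, or_iff_right two_ne_zero,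
    Finset.sum_eq_zero_iff_of_nonneg fun v _ => Finset.sum_nonneg fun i _ =>
      mul_nonneg (share_nonneg r v i) (sq_nonneg _)] at h
  refine eq_of_forall_eq_at_vertex hG (fun v k l hk hl => ?_) i j
  have hv := h v (Finset.mem_univ v)
  rw [Finset.sum_eq_zero_iff_of_nonneg fun i _ =>
    mul_nonneg (share_nonneg r v i) (sq_nonneg _)] at hv
  have hm : ∀ m : G.edgeSet, v ∈ (m : Sym2 V) → f m = ∑ j, share r v j * f j := fun m hm => by
    have := (mul_eq_zero.1 (hv m (Finset.mem_univ m))).resolve_left (share_pos r hm).ne'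
    exact sub_eq_zero.1 (pow_eq_zero_iff two_ne_zero |>.1 this)
  rw [hm k hk, hm l hl]

/-! ## Weights of constant curvature -/

theorem card_edgeFinset_pos [Nontrivial V] (hG : G.Connected) :
    (0 : ℝ) < (G.edgeFinset.card : ℝ) := by
  obtain ⟨v⟩ := hG.nonempty
  obtain ⟨i, -⟩ := exists_edge_mem hG v
  exact Nat.cast_pos.2 (Finset.card_pos.2 ⟨(i : Sym2 V), SimpleGraph.mem_edgeFinset.2 i.2⟩)

theorem card_edgeSet : (Fintype.card G.edgeSet : ℝ) = (G.edgeFinset.card : ℝ) := by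
  rw [SimpleGraph.edgeFinset_card]

/-- The curvature minus its average. -/
def excess (G : SimpleGraph V) [DecidableRel G.Adj] (r : G.edgeSet → ℝ) (i : G.edgeSet) : ℝ :=
  curvature G r i - averageCurvature G

theorem excess_eq (hG : G.Connected) (hg : 6 ≤ G.egirth) (r : G.edgeSet → ℝ) (i : G.edgeSet) :
    excess G r i =
      2 * (∑ v, share r v i - (Fintype.card V : ℝ) / (G.edgeFinset.card : ℝ)) := by
  rw [excess, curvature_eq hG hg, averageCurvature]
  ring

/-- A Gauss–Bonnet count: every vertex distributes total share `1`, so the shares add up to `|V|`. A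
constant excess must therefore be zero. -/
theorem sum_excess [Nontrivial V] (hG : G.Connected) (hg : 6 ≤ G.egirth) (r : G.edgeSet → ℝ) :
    ∑ i, excess G r i = 0 := by
  simp only [excess_eq hG hg, ← Finset.mul_sum, Finset.sum_sub_distrib]
  rw [Finset.sum_comm]
  simp only [sum_share hG, Finset.sum_const, Finset.card_univ, nsmul_eq_mul, mul_one, card_edgeSet]
  rw [mul_div_cancel₀ _ (card_edgeFinset_pos hG).ne', sub_self, mul_zero]

theorem continuous_excess (hG : G.Connected) (hg : 6 ≤ G.egirth) : Continuous (excess G) :=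
  continuous_pi fun i => (continuous_curvature hG hg i).sub continuous_const

theorem excess_eq_zero_of_const [Nontrivial V] (hG : G.Connected) (hg : 6 ≤ G.egirth)
    {r : G.edgeSet → ℝ} (h : ∀ i j, excess G r i = excess G r j) : excess G r = 0 := by
  funext i
  have h1 := sum_excess hG hg r
  simp only [h _ i, Finset.sum_const, Finset.card_univ, nsmul_eq_mul, card_edgeSet] at h1
  exact (mul_eq_zero.1 h1).resolve_left (card_edgeFinset_pos hG).ne'

/-- Only differences of `r` appear here, which makes the share monotone in them; this is what the
comparison argument below uses. -/
theorem share_eq_inv (r : G.edgeSet → ℝ) {v : V} {i : G.edgeSet} (hi : v ∈ (i : Sym2 V)) :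
    share r v i =
      (∑ j : G.edgeSet, if v ∈ (j : Sym2 V) then Real.exp (r j - r i) else 0)⁻¹ := by
  rw [share, if_pos hi, expSum]
  have : (∑ j : G.edgeSet, if v ∈ (j : Sym2 V) then Real.exp (r j - r i) else 0) =
      (∑ j : G.edgeSet, if v ∈ (j : Sym2 V) then Real.exp (r j) else 0) / Real.exp (r i) := by
    rw [Finset.sum_div]
    refine Finset.sum_congr rfl fun j _ => ?_
    split_ifs
    · rw [Real.exp_sub]
    · simp
  rw [this, inv_div]

/-- Up to an additive constant, the logarithmic weight is determined by its curvature. -/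
theorem sub_eq_of_excess_eq (hG : G.Connected) (hg : 6 ≤ G.egirth) {a b : G.edgeSet → ℝ}
    (h : excess G a = excess G b) (i j : G.edgeSet) : a i - b i = a j - b j := by
  -- Maximum principle: where `a - b` is maximal, all differences `a j - a k` are at most `b j - b
  -- k`, so each share under `a` is at least the one under `b`. Equal curvatures force equality term
  -- by term, and the maximum spreads to adjacent edges.
  obtain ⟨m, -, hm⟩ := Finset.exists_max_image Finset.univ (fun i => a i - b i) ⟨i, by simp⟩
  have hmax : ∀ k, a k - b k ≤ a m - b m := fun k => hm k (Finset.mem_univ k)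
  suffices hall : ∀ k, a k - b k = a m - b m by rw [hall i, hall j]
  refine edge_induction hG (i := m) (fun v k l hk hl hkm => ?_) rfl
  have hsum : ∑ w, share a w k = ∑ w, share b w k := by
    have := congrFun h k
    rw [excess_eq hG hg, excess_eq hG hg] at this
    linarith
  have hpos : ∀ (r : G.edgeSet → ℝ) (w : V), w ∈ (k : Sym2 V) →
      0 < ∑ j : G.edgeSet, if w ∈ (j : Sym2 V) then Real.exp (r j - r k) else 0 := by
    intro r w hw
    rw [← inv_pos, ← share_eq_inv r hw]
    exact share_pos r hw
  have hterm : ∀ (w : V) (j : G.edgeSet),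
      (if w ∈ (j : Sym2 V) then Real.exp (a j - a k) else 0) ≤
        if w ∈ (j : Sym2 V) then Real.exp (b j - b k) else 0 := fun w j => by
    split_ifs
    · exact Real.exp_le_exp.2 (by linarith [hmax j])
    · exact le_rfl
  have hle : ∀ w ∈ Finset.univ, share b w k ≤ share a w k := by
    intro w _
    by_cases hw : w ∈ (k : Sym2 V)
    · rw [share_eq_inv a hw, share_eq_inv b hw]
      exact inv_anti₀ (hpos a w hw) (Finset.sum_le_sum fun j _ => hterm w j)
    · rw [share_of_notMem a hw, share_of_notMem b hw]
  have heq := (Finset.sum_eq_sum_iff_of_le hle).1 hsum.symm v (Finset.mem_univ v)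
  rw [share_eq_inv a hk, share_eq_inv b hk, inv_inj] at heq
  have hl' := (Finset.sum_eq_sum_iff_of_le fun j _ => hterm v j).1 heq.symm l (Finset.mem_univ l)
  rw [if_pos hl, if_pos hl, Real.exp_eq_exp] at hl'
  linarith

theorem eq_of_excess_eq [Nontrivial V] (hG : G.Connected) (hg : 6 ≤ G.egirth)
    {a b : G.edgeSet → ℝ} (hs : ∑ i, a i = ∑ i, b i) (h : excess G a = excess G b) : a = b := by
  funext i
  have h1 : ∑ j, (a j - b j) = 0 := by rw [Finset.sum_sub_distrib, hs, sub_self]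
  simp only [sub_eq_of_excess_eq hG hg h _ i, Finset.sum_const, Finset.card_univ, nsmul_eq_mul,
    card_edgeSet] at h1
  exact sub_eq_zero.1 ((mul_eq_zero.1 h1).resolve_left (card_edgeFinset_pos hG).ne')

/-! ### The density condition and its necessity -/

/-- The edges with both endpoints in `Ω`. -/
def edgesInside (G : SimpleGraph V) [DecidableRel G.Adj] (Ω : Finset V) : Finset G.edgeSet :=
  Finset.univ.filter fun i => ∀ v ∈ (i : Sym2 V), v ∈ Ω

theorem ncard_induce_edgeSet (Ω : Finset V) :
    (G.induce (Ω : Set V)).edgeSet.ncard = (edgesInside G Ω).card := by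
  have h1 : (G.induce (Ω : Set V)).edgeSet.ncard =
      (Sym2.map Subtype.val '' (G.induce (Ω : Set V)).edgeSet : Set (Sym2 V)).ncard :=
    (Set.ncard_image_of_injective _ (Sym2.map.injective Subtype.val_injective)).symm
  have h2 : (edgesInside G Ω).card =
      (Subtype.val '' (edgesInside G Ω : Set G.edgeSet) : Set (Sym2 V)).ncard := by
    rw [Set.ncard_image_of_injective _ Subtype.val_injective, Set.ncard_coe_finset]
  rw [h1, h2]
  congr 1
  ext e
  constructor
  · rintro ⟨e', he', rfl⟩
    induction e' with
    | _ x y =>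
      refine ⟨⟨s(x.1, y.1), he'⟩, ?_, rfl⟩
      simp [edgesInside]
  · rintro ⟨⟨e', he'⟩, hi, rfl⟩
    induction e' with
    | _ x y =>
      simp only [edgesInside, Finset.coe_filter, Finset.mem_univ, true_and, Set.mem_ofPred_eq,
        Sym2.mem_iff, forall_eq_or_imp, forall_eq] at hi
      exact ⟨s(⟨x, hi.1⟩, ⟨y, hi.2⟩), he', rfl⟩

theorem maxDensity_lt_iff [Nontrivial V] (hG : G.Connected) :
    maxDensity G < (G.edgeFinset.card : ℝ) / (Fintype.card V : ℝ) ↔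
      ∀ Ω : Finset V, Ω.Nonempty → Ω ≠ Finset.univ →
        (Fintype.card V : ℝ) / (G.edgeFinset.card : ℝ) * ((edgesInside G Ω).card : ℝ) <
          (Ω.card : ℝ) := by
  have hE := card_edgeFinset_pos hG
  have hV : (0 : ℝ) < Fintype.card V := by exact_mod_cast Fintype.card_pos
  rw [maxDensity, Finset.sup'_lt_iff]
  refine forall_congr' fun Ω => ?_
  simp only [properSubsets, Finset.mem_filter, Finset.mem_univ, true_and, and_imp,
    Finset.ssubset_univ_iff]
  refine forall_congr' fun hne => forall_congr' fun _ => ?_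
  have hΩ : (0 : ℝ) < Ω.card := by exact_mod_cast hne.card_pos
  rw [density, ncard_induce_edgeSet, div_lt_div_iff₀ hΩ hV, div_mul_eq_mul_div, div_lt_iff₀ hE,
    mul_comm, mul_comm (Ω.card : ℝ)]

/-- In a connected graph, some edge leaves a proper nonempty set of vertices. -/
theorem exists_adj_mem_notMem (hG : G.Connected) {Ω : Finset V} (hne : Ω.Nonempty)
    (huniv : Ω ≠ Finset.univ) : ∃ v ∈ Ω, ∃ w, w ∉ Ω ∧ G.Adj v w := by
  by_contra! hcon
  obtain ⟨a, ha⟩ := hne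
  refine huniv (Finset.eq_univ_of_forall fun w => ?_)
  obtain ⟨p⟩ := hG.preconnected a w
  induction p with
  | nil => exact ha
  | cons h p ih =>
    refine ih ?_
    by_contra hv
    exact hcon _ ha _ hv h

/-- Edges inside `Ω` receive their whole share `|V| / |E|` from vertices of `Ω`, each of which has
only `1` to give. An edge leaving `Ω` takes a positive part, hence strictness. -/
theorem density_lt_of_excess_eq_zero [Nontrivial V] (hG : G.Connected) (hg : 6 ≤ G.egirth)
    {r : G.edgeSet → ℝ} (hr : excess G r = 0) {Ω : Finset V} (hne : Ω.Nonempty)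
    (huniv : Ω ≠ Finset.univ) :
    (Fintype.card V : ℝ) / (G.edgeFinset.card : ℝ) * ((edgesInside G Ω).card : ℝ) <
      (Ω.card : ℝ) := by
  have hsum : ∀ i, ∑ v, share r v i = (Fintype.card V : ℝ) / (G.edgeFinset.card : ℝ) := fun i => by
    have := congrFun hr i
    rw [excess_eq hG hg, Pi.zero_apply] at this
    linarith
  have h1 : (Fintype.card V : ℝ) / (G.edgeFinset.card : ℝ) * ((edgesInside G Ω).card : ℝ) =
      ∑ v ∈ Ω, ∑ i ∈ edgesInside G Ω, share r v i := by
    rw [Finset.sum_comm, mul_comm, ← nsmul_eq_mul, ← Finset.sum_const]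
    refine Finset.sum_congr rfl fun i hi => ?_
    rw [← hsum i]
    refine (Finset.sum_subset (Finset.subset_univ Ω) fun v _ hv =>
      share_of_notMem r fun h => ?_).symm
    exact hv ((Finset.mem_filter.1 hi).2 v h)
  have h2 : (Ω.card : ℝ) = ∑ v ∈ Ω, 1 := by simp
  rw [h1, h2]
  obtain ⟨v, hv, w, hw, hvw⟩ := exists_adj_mem_notMem hG hne huniv
  refine Finset.sum_lt_sum (fun x _ => ?_) ⟨v, hv, ?_⟩
  · rw [← sum_share hG r x]
    exact Finset.sum_le_sum_of_subset_of_nonneg (Finset.subset_univ _)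
      fun i _ _ => share_nonneg r x i
  · rw [← sum_share hG r v]
    refine Finset.sum_lt_sum_of_subset (Finset.subset_univ _)
      (i := ⟨s(v, w), hvw⟩) (Finset.mem_univ _) ?_ (share_pos r (by simp))
      fun i _ _ => share_nonneg r v i
    simp [edgesInside, hw]

end Shares

section Potential

variable {V : Type*} [Fintype V] [DecidableEq V] {G : SimpleGraph V} [DecidableRel G.Adj]

/-! ## The potential of the curvature -/

/-- The convex potential whose gradient is the excess curvature. -/
def potential (G : SimpleGraph V) [DecidableRel G.Adj] (r : G.edgeSet → ℝ) : ℝ :=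
  2 * (∑ v, Real.log (expSum r v) -
    (Fintype.card V : ℝ) / (G.edgeFinset.card : ℝ) * ∑ i, r i)

theorem continuous_expSum (v : V) : Continuous fun r : G.edgeSet → ℝ => expSum r v := by
  refine continuous_finsetSum _ fun j _ => ?_
  split_ifs <;> fun_prop

theorem continuous_potential [Nontrivial V] (hG : G.Connected) : Continuous (potential G) := by
  refine continuous_const.mul (Continuous.sub (continuous_finsetSum _ fun v _ => ?_) (by fun_prop))
  exact (continuous_expSum v).log fun r => (expSum_pos hG r v).ne'

theorem hasGradientField_potential [Nontrivial V] (hG : G.Connected) (hg : 6 ≤ G.egirth) :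
    HasGradientField (potential G) (excess G) := by
  intro r w s t hr
  have hri := hasDerivWithinAt_pi.1 hr
  have hexp : ∀ v : V, HasDerivWithinAt (fun t => expSum (r t) v)
      (∑ i : G.edgeSet, if v ∈ (i : Sym2 V) then Real.exp (r t i) * w i else 0) s t := by
    intro v
    refine HasDerivWithinAt.fun_sum fun i _ => ?_
    by_cases hi : v ∈ (i : Sym2 V)
    · simpa only [if_pos hi] using (hri i).exp
    · simpa only [if_neg hi] using hasDerivWithinAt_const t s (0 : ℝ)
  have hlog := HasDerivWithinAt.fun_sum (u := Finset.univ) fun v _ =>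
    (hexp v).log (expSum_pos hG (r t) v).ne'
  have hsum := HasDerivWithinAt.fun_sum (u := Finset.univ) fun i _ => hri i
  have h := (hlog.fun_sub (hsum.const_mul
    ((Fintype.card V : ℝ) / (G.edgeFinset.card : ℝ)))).const_mul 2
  convert! h using 1
  have h1 : ∀ v : V, (∑ i : G.edgeSet, if v ∈ (i : Sym2 V) then Real.exp (r t i) * w i else 0) /
      expSum (r t) v = ∑ i, share (r t) v i * w i := by
    intro v
    rw [Finset.sum_div]
    refine Finset.sum_congr rfl fun i _ => ?_
    unfold share
    split_ifs
    · ring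
    · simp
  simp only [h1]
  rw [Finset.sum_comm]
  simp only [excess_eq hG hg, mul_assoc, ← Finset.mul_sum, sub_mul, Finset.sum_sub_distrib,
    Finset.sum_mul]

/-! ### Coercivity of the potential -/

theorem log_expSum_ge (r : G.edgeSet → ℝ) {v : V} {i : G.edgeSet} (hi : v ∈ (i : Sym2 V)) :
    r i ≤ Real.log (expSum r v) := by
  rw [Real.le_log_iff_exp_le (expSum_pos_of_mem r hi), expSum]
  refine le_trans (by rw [if_pos hi]) (Finset.single_le_sum
    (f := fun j : G.edgeSet => if v ∈ (j : Sym2 V) then Real.exp (r j) else 0) (fun j _ => ?_)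
    (Finset.mem_univ i))
  split_ifs
  exacts [(Real.exp_pos _).le, le_rfl]

theorem integral_ite_le {a b c : ℝ} (h : c ∈ Set.Icc a b) :
    ∫ t in a..b, (if t ≤ c then (1 : ℝ) else 0) = c - a := by
  have := intervalIntegral.integral_indicator (μ := MeasureTheory.volume) (f := fun _ => (1 : ℝ)) h
  simpa [Set.indicator] using this

theorem intervalIntegrable_ite_le (a b c : ℝ) :
    IntervalIntegrable (fun t => if t ≤ c then (1 : ℝ) else 0) MeasureTheory.volume a b := by
  refine Antitone.intervalIntegrable fun x y hxy => ?_
  by_cases hy : y ≤ c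
  · simp [hy, hxy.trans hy]
  · simp only [hy, if_false]
    split_ifs <;> norm_num

theorem intervalIntegrable_sum_ite_le {κ : Type*} [Fintype κ] (f : κ → ℝ) (a b : ℝ) :
    IntervalIntegrable (fun t => ∑ k, if t ≤ f k then (1 : ℝ) else 0) MeasureTheory.volume a b := by
  have := IntervalIntegrable.sum Finset.univ fun k _ => intervalIntegrable_ite_le a b (f k)
  simpa only [Finset.sum_fn] using this

/-- Layer-cake estimate: density bounds for vertex sets give bounds for vertex functions. -/
theorem layerCake_le {c δ : ℝ} (hc : 0 ≤ c)
    (hδ : ∀ Ω : Finset V, Ω.Nonempty → Ω ≠ Finset.univ →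
      δ ≤ (Ω.card : ℝ) - c * ((edgesInside G Ω).card : ℝ))
    (hbal : (Fintype.card V : ℝ) = c * (G.edgeFinset.card : ℝ))
    {M : V → ℝ} {r : G.edgeSet → ℝ} (hr : ∀ i : G.edgeSet, ∀ v ∈ (i : Sym2 V), r i ≤ M v)
    {p q : V} (hp : ∀ v, M v ≤ M p) (hq : ∀ v, M q ≤ M v) :
    δ * (M p - M q) ≤ ∑ v, M v - c * ∑ i, r i := by
  have hle : M q ≤ M p := hq p
  have hV : ∑ v, ∫ t in M q..M p, (if t ≤ M v then (1 : ℝ) else 0) =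
      ∑ v, M v - (Fintype.card V : ℝ) * M q := by
    simp only [integral_ite_le ⟨hq _, hp _⟩, Finset.sum_sub_distrib, Finset.sum_const,
      Finset.card_univ, nsmul_eq_mul]
  -- Only an inequality, because `r i` may lie below `M q`, where the integral stops at zero.
  have hE : ∑ i, r i - (G.edgeFinset.card : ℝ) * M q ≤
      ∑ i, ∫ t in M q..M p, (if t ≤ r i then (1 : ℝ) else 0) := by
    have : ∑ i, (r i - M q) = ∑ i, r i - (G.edgeFinset.card : ℝ) * M q := by
      simp only [Finset.sum_sub_distrib, Finset.sum_const, Finset.card_univ, nsmul_eq_mul,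
        card_edgeSet]
    rw [← this]
    refine Finset.sum_le_sum fun i _ => ?_
    by_cases hi : M q ≤ r i
    · rw [integral_ite_le ⟨hi, (hr i _ (Sym2.out_fst_mem _)).trans (hp _)⟩]
    · refine (sub_nonpos.2 (not_le.1 hi).le).trans
        (intervalIntegral.integral_nonneg hle fun t _ => ?_)
      split_ifs <;> norm_num
  have hint : δ * (M p - M q) ≤ ∫ t in M q..M p, (∑ v, (if t ≤ M v then (1 : ℝ) else 0) -
      c * ∑ i, (if t ≤ r i then (1 : ℝ) else 0)) := by
    have hconst : ∫ _ in M q..M p, δ = δ * (M p - M q) := by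
      rw [intervalIntegral.integral_const, smul_eq_mul, mul_comm]
    rw [← hconst]
    -- Strictly between the extreme values, the superlevel set of `M` is nonempty and proper (at `M
    -- q` it would be all of `V`). It contains both endpoints of every edge with `t ≤ r i`.
    refine intervalIntegral.integral_mono_on_of_le_Ioo hle intervalIntegrable_const ?_
      fun t ht => ?_
    · exact (intervalIntegrable_sum_ite_le M _ _).sub
        ((intervalIntegrable_sum_ite_le r _ _).const_mul c)
    · have h1 := hδ (Finset.univ.filter fun v => t ≤ M v) ⟨p, by simpa using ht.2.le⟩ fun h => by
        exact absurd (Finset.mem_filter.1 (h.symm.subset (Finset.mem_univ q))).2 (not_le.2 ht.1)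
      refine h1.trans ?_
      rw [← Finset.sum_filter, ← Finset.sum_filter, Finset.sum_const, Finset.sum_const,
        nsmul_eq_mul, nsmul_eq_mul, mul_one, mul_one]
      refine sub_le_sub_left (mul_le_mul_of_nonneg_left ?_ hc) _
      refine Nat.cast_le.2 (Finset.card_le_card fun i hi => ?_)
      simp only [edgesInside, Finset.mem_filter, Finset.mem_univ, true_and] at hi ⊢
      exact fun v hv => hi.trans (hr i v hv)
  rw [intervalIntegral.integral_sub (intervalIntegrable_sum_ite_le M _ _)
    ((intervalIntegrable_sum_ite_le r _ _).const_mul c),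
    intervalIntegral.integral_const_mul,
    intervalIntegral.integral_finsetSum fun v _ => intervalIntegrable_ite_le _ _ _,
    intervalIntegral.integral_finsetSum fun i _ => intervalIntegrable_ite_le _ _ _, hV] at hint
  -- The balance `hbal` cancels the two multiples of `M q`.
  have := mul_le_mul_of_nonneg_left hE hc
  rw [mul_sub, ← mul_assoc, ← hbal] at this
  linarith

theorem exists_density_gap [Nontrivial V] {c : ℝ}
    (h : ∀ Ω : Finset V, Ω.Nonempty → Ω ≠ Finset.univ →
      c * ((edgesInside G Ω).card : ℝ) < (Ω.card : ℝ)) :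
    ∃ δ > 0, ∀ Ω : Finset V, Ω.Nonempty → Ω ≠ Finset.univ →
      δ ≤ (Ω.card : ℝ) - c * ((edgesInside G Ω).card : ℝ) := by
  obtain ⟨Ω, hΩ, hmin⟩ := Finset.exists_min_image (properSubsets V)
    (fun Ω => (Ω.card : ℝ) - c * ((edgesInside G Ω).card : ℝ)) (properSubsets_nonempty V)
  simp only [properSubsets, Finset.mem_filter, Finset.mem_univ, true_and,
    Finset.ssubset_univ_iff] at hΩ hmin
  exact ⟨_, sub_pos.2 (h Ω hΩ.1 hΩ.2), fun Ω' h1 h2 => hmin Ω' ⟨h1, h2⟩⟩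

/-- Under the density condition the potential controls the oscillation. -/
theorem exists_sub_le_potential [Nontrivial V] (hG : G.Connected)
    (h : ∀ Ω : Finset V, Ω.Nonempty → Ω ≠ Finset.univ →
      (Fintype.card V : ℝ) / (G.edgeFinset.card : ℝ) * ((edgesInside G Ω).card : ℝ) <
        (Ω.card : ℝ)) :
    ∃ C, 0 ≤ C ∧ ∀ (r : G.edgeSet → ℝ) (i j : G.edgeSet), r i - r j ≤ C * potential G r := by
  have hE := card_edgeFinset_pos hG
  have hV : (0 : ℝ) < Fintype.card V := by exact_mod_cast Fintype.card_pos
  obtain ⟨δ, hδ0, hδ⟩ := exists_density_gap h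
  set c := (Fintype.card V : ℝ) / (G.edgeFinset.card : ℝ) with hc
  have hc0 : 0 < c := div_pos hV hE
  have hbal : (Fintype.card V : ℝ) = c * (G.edgeFinset.card : ℝ) := by
    rw [hc, div_mul_cancel₀ _ hE.ne']
  refine ⟨(1 / δ + 1 / c) / 2, div_nonneg (add_nonneg (one_div_nonneg.2 hδ0.le)
    (one_div_nonneg.2 hc0.le)) zero_le_two, fun r i j => ?_⟩
  set M : V → ℝ := fun v => Real.log (expSum r v) with hM
  set L : ℝ := ∑ v, M v - c * ∑ i, r i with hL
  have hpot : potential G r = 2 * L := rfl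
  have hrM : ∀ i : G.edgeSet, ∀ v ∈ (i : Sym2 V), r i ≤ M v := fun i v hv => log_expSum_ge r hv
  obtain ⟨p, -, hp⟩ := Finset.exists_max_image Finset.univ M Finset.univ_nonempty
  obtain ⟨q, -, hq⟩ := Finset.exists_min_image Finset.univ M Finset.univ_nonempty
  have hp' : ∀ v, M v ≤ M p := fun v => hp v (Finset.mem_univ v)
  have hq' : ∀ v, M q ≤ M v := fun v => hq v (Finset.mem_univ v)
  have h1 : δ * (M p - M q) ≤ L := layerCake_le hc0.le hδ hbal hrM hp' hq'
  -- A very negative `r j` is invisible to the superlevel sets. Raising it to `M q` keeps the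
  -- constraints, so the modified right-hand side is still nonnegative; the raise cost exactly `c *
  -- (M q - r j)`.
  have h2 : c * (M q - r j) ≤ L := by
    have h3 := layerCake_le hc0.le hδ hbal (M := M) (r := Function.update r j (M q))
      (fun k v hv => by
        by_cases hkj : k = j
        · subst hkj
          rw [Function.update_self]
          exact hq' v
        · simpa [hkj] using hrM k v hv) hp' hq'
    have h4 : ∑ k, Function.update r j (M q) k = ∑ k, r k + (M q - r j) := by
      rw [Finset.sum_update_of_mem (Finset.mem_univ j),
        ← Finset.add_sum_erase Finset.univ r (Finset.mem_univ j), Finset.sdiff_singleton_eq_erase]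
      ring
    rw [h4, mul_add] at h3
    have := mul_nonneg hδ0.le (sub_nonneg.2 (hp' q))
    linarith
  have h5 : r i ≤ M p := (hrM i _ (Sym2.out_fst_mem _)).trans (hp' _)
  rw [← le_div_iff₀' hδ0] at h1
  rw [← le_div_iff₀' hc0] at h2
  rw [hpot]
  have : (1 / δ + 1 / c) / 2 * (2 * L) = L / δ + L / c := by ring
  rw [this]
  linarith

/-- With the sum fixed, a bound on the oscillation bounds the distance to the constant vector with
the mean value `S / |E|`. -/
theorem isCompact_potential_le [Nontrivial V] (hG : G.Connected)
    (h : ∀ Ω : Finset V, Ω.Nonempty → Ω ≠ Finset.univ →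
      (Fintype.card V : ℝ) / (G.edgeFinset.card : ℝ) * ((edgesInside G Ω).card : ℝ) <
        (Ω.card : ℝ)) (S c : ℝ) :
    IsCompact {r : G.edgeSet → ℝ | ∑ i, r i = S ∧ potential G r ≤ c} := by
  obtain ⟨C, hC0, hC⟩ := exists_sub_le_potential hG h
  have hE := card_edgeFinset_pos hG
  refine Metric.isCompact_of_isClosed_isBounded ?_ ?_
  · exact (isClosed_eq (by fun_prop) continuous_const).inter
      (isClosed_le (continuous_potential hG) continuous_const)
  · refine (Metric.isBounded_closedBall
      (x := (fun _ => S / (G.edgeFinset.card : ℝ) : G.edgeSet → ℝ)) (r := C * |c|)).subset ?_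
    rintro r ⟨hS, hc⟩
    have hosc : ∀ i j, r i - r j ≤ C * |c| := fun i j =>
      (hC r i j).trans (mul_le_mul_of_nonneg_left (hc.trans (le_abs_self c)) hC0)
    rw [Metric.mem_closedBall, dist_pi_le_iff (by positivity)]
    intro i
    have h1 : (G.edgeFinset.card : ℝ) * (r i) - S ≤ (G.edgeFinset.card : ℝ) * (C * |c|) := by
      have := Finset.sum_le_sum fun j (_ : j ∈ Finset.univ) => hosc i j
      simpa only [Finset.sum_sub_distrib, Finset.sum_const, Finset.card_univ, nsmul_eq_mul,
        card_edgeSet, hS] using this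
    have h2 : S - (G.edgeFinset.card : ℝ) * (r i) ≤ (G.edgeFinset.card : ℝ) * (C * |c|) := by
      have := Finset.sum_le_sum fun j (_ : j ∈ Finset.univ) => hosc j i
      simpa only [Finset.sum_sub_distrib, Finset.sum_const, Finset.card_univ, nsmul_eq_mul,
        card_edgeSet, hS] using this
    have h3 : r i - S / (G.edgeFinset.card : ℝ) =
        ((G.edgeFinset.card : ℝ) * (r i) - S) / (G.edgeFinset.card : ℝ) := by
      rw [sub_div, mul_div_cancel_left₀ _ hE.ne']
    rw [Real.dist_eq, h3, abs_div, abs_of_pos hE, div_le_iff₀ hE, abs_le]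
    constructor <;> linarith

/-! ## Flows with constant curvature limit -/

/-- The dynamics play no role: the existence of a weight of constant curvature is enough. -/
theorem maxDensity_lt_of_converges [Nontrivial V] (hG : G.Connected) (hg : 6 ≤ G.egirth)
    {F : (G.edgeSet → ℝ) → G.edgeSet → ℝ} {r₀ : G.edgeSet → ℝ}
    (h : ConvergesToConstantCurvature G F r₀) :
    maxDensity G < (G.edgeFinset.card : ℝ) / (Fintype.card V : ℝ) := by
  obtain ⟨a, ha, -⟩ := h
  have ha' : excess G a = 0 := funext fun i => sub_eq_zero.2 (ha i)
  exact (maxDensity_lt_iff hG).2 fun Ω h1 h2 => density_lt_of_excess_eq_zero hG hg ha' h1 h2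

/-- A dissipative continuous field preserving the total logarithmic weight flows to constant
curvature if and only if the density condition holds. -/
theorem converges_iff [Nontrivial V] (hG : G.Connected) (hg : 6 ≤ G.egirth)
    {F : (G.edgeSet → ℝ) → G.edgeSet → ℝ} (hFc : Continuous F) (hFsum : ∀ r, ∑ i, F r i = 0)
    (hF : ∀ r, ∑ i, excess G r i * F r i ≤ 0)
    (hF0 : ∀ r, ∑ i, excess G r i * F r i = 0 → ∀ i j, excess G r i = excess G r j)
    (r₀ : G.edgeSet → ℝ) :
    ConvergesToConstantCurvature G F r₀ ↔
      maxDensity G < (G.edgeFinset.card : ℝ) / (Fintype.card V : ℝ) := by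
  refine ⟨maxDensity_lt_of_converges hG hg, fun h => ?_⟩
  obtain ⟨a, ha, hex, hconv⟩ := exists_tendsto_of_lyapunov (continuous_potential hG)
    (continuous_excess hG hg) hFc (hasGradientField_potential hG hg) (sum_excess hG hg) hFsum hF
    (fun r hr => excess_eq_zero_of_const hG hg (hF0 r hr))
    (isCompact_potential_le hG ((maxDensity_lt_iff hG).1 h))
    (fun a b hs h1 h2 => eq_of_excess_eq hG hg hs (h1.trans h2.symm)) r₀
  exact ⟨a, fun i => sub_eq_zero.1 (congrFun ha i), hex, hconv⟩

end Potential

/-! ## The modified Calabi flow -/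

section Modified

variable {V : Type*} [Fintype V] [DecidableEq V] {G : SimpleGraph V} [DecidableRel G.Adj]

theorem modifiedField_apply (r : G.edgeSet → ℝ) (i : G.edgeSet) :
    modifiedField G r i = -∑ j, partialCurvature G r i j * excess G r j := rfl

theorem modifiedField_converges_iff [Nontrivial V] (hG : G.Connected) (hg : 6 ≤ G.egirth)
    (r₀ : G.edgeSet → ℝ) :
    ConvergesToConstantCurvature G (modifiedField G) r₀ ↔
      maxDensity G < (G.edgeFinset.card : ℝ) / (Fintype.card V : ℝ) := by
  have hquad : ∀ r, ∑ i, excess G r i * modifiedField G r i =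
      -∑ i, excess G r i * ∑ j, partialCurvature G r i j * excess G r j := fun r => by
    simp only [modifiedField_apply, mul_neg, Finset.sum_neg_distrib]
  refine converges_iff hG hg ?_ (fun r => ?_) (fun r => ?_) (fun r hr => ?_) r₀
  · refine continuous_pi fun i => ?_
    simp only [modifiedField_apply]
    refine Continuous.neg (continuous_finsetSum _ fun j _ => ?_)
    exact (continuous_partialCurvature hG hg i j).mul
      ((continuous_apply j).comp (continuous_excess hG hg))
  · simp only [modifiedField_apply, Finset.sum_neg_distrib, neg_eq_zero]
    rw [Finset.sum_comm]
    simp only [← Finset.sum_mul, partialCurvature_comm hG hg r _, sum_partialCurvature hG hg,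
      zero_mul, Finset.sum_const_zero]
  · rw [hquad]
    exact neg_nonpos.2 (quadraticForm_nonneg hG hg r _)
  · rw [hquad, neg_eq_zero] at hr
    exact eq_of_quadraticForm_eq_zero hG hg hr

/-! ## The `p`-th Calabi flow -/

/-- For `p < 2` the first factor blows up at `0`, but the product is dominated by `|x| ^ (p - 1)`,
which tends to `0` exactly because `1 < p`. -/
theorem continuous_abs_rpow_mul {p : ℝ} (hp : 1 < p) :
    Continuous fun x : ℝ => |x| ^ (p - 2) * x := by
  rw [continuous_iff_continuousAt]
  intro x
  by_cases hx : x = 0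
  · subst hx
    have h1 : ∀ x : ℝ, ‖|x| ^ (p - 2) * x‖ ≤ |x| ^ (p - 1) := fun x => by
      rw [norm_mul, Real.norm_of_nonneg (Real.rpow_nonneg (abs_nonneg x) _), Real.norm_eq_abs]
      by_cases hx : x = 0
      · simp [hx, Real.rpow_nonneg]
      · rw [← Real.rpow_add_one (abs_ne_zero.2 hx)]
        exact le_of_eq (by congr 1; ring)
    have h2 : Filter.Tendsto (fun x : ℝ => |x| ^ (p - 1)) (𝓝 0) (𝓝 0) := by
      have : Continuous fun x : ℝ => |x| ^ (p - 1) :=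
        continuous_abs.rpow_const fun _ => Or.inr (by linarith)
      have h := this.tendsto 0
      rwa [abs_zero, Real.zero_rpow (by linarith)] at h
    have h3 := squeeze_zero_norm h1 h2
    simpa [ContinuousAt] using h3
  · exact (continuous_abs.continuousAt.rpow_const (Or.inl (abs_ne_zero.2 hx))).mul continuousAt_id

/-- The flux of the `p`-Laplacian from the edge `j` to the edge `i`. -/
def pFlux (G : SimpleGraph V) [DecidableRel G.Adj] (p : ℝ) (r : G.edgeSet → ℝ) (i j : G.edgeSet) :
    ℝ :=
  open Classical in
  if G.lineGraph.Adj i j then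
    -partialCurvature G r i j *
      (|excess G r j - excess G r i| ^ (p - 2) * (excess G r j - excess G r i))
  else 0

theorem pField_apply (p : ℝ) (r : G.edgeSet → ℝ) (i : G.edgeSet) :
    pField G p r i = ∑ j, pFlux G p r i j := by
  classical
  unfold pField pLaplace pFlux
  rw [Finset.sum_filter]
  refine Finset.sum_congr rfl fun j _ => ?_
  simp only [mul_assoc]
  rfl

theorem pFlux_antisymm (hG : G.Connected) (hg : 6 ≤ G.egirth) (p : ℝ) (r : G.edgeSet → ℝ)
    (i j : G.edgeSet) : pFlux G p r j i = -pFlux G p r i j := by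
  unfold pFlux
  by_cases h : G.lineGraph.Adj i j
  · rw [if_pos h, if_pos h.symm, partialCurvature_comm hG hg r j i, abs_sub_comm]
    ring
  · rw [if_neg h, if_neg fun h' => h h'.symm, neg_zero]

theorem sub_mul_pFlux_nonpos (hG : G.Connected) (hg : 6 ≤ G.egirth) (p : ℝ) (r : G.edgeSet → ℝ)
    (i j : G.edgeSet) : (excess G r i - excess G r j) * pFlux G p r i j ≤ 0 := by
  unfold pFlux
  split_ifs with h
  · have h1 := neg_nonneg.2 (partialCurvature_neg hG hg r h).le
    have h2 := Real.rpow_nonneg (abs_nonneg (excess G r j - excess G r i)) (p - 2)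
    have := mul_nonneg (mul_nonneg h1 h2) (mul_self_nonneg (excess G r j - excess G r i))
    nlinarith
  · simp

theorem eq_of_sub_mul_pFlux_eq_zero (hG : G.Connected) (hg : 6 ≤ G.egirth) {p : ℝ}
    {r : G.edgeSet → ℝ} {i j : G.edgeSet} (h : G.lineGraph.Adj i j)
    (h0 : (excess G r i - excess G r j) * pFlux G p r i j = 0) : excess G r i = excess G r j := by
  by_contra hne
  have h1 := sub_ne_zero.2 hne
  have h2 := sub_ne_zero.2 (Ne.symm hne)
  have h3 := (Real.rpow_pos_of_pos (abs_pos.2 h2) (p - 2)).ne'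
  have h4 := neg_ne_zero.2 (partialCurvature_neg hG hg r h).ne
  rw [pFlux, if_pos h] at h0
  exact mul_ne_zero h1 (mul_ne_zero h4 (mul_ne_zero h3 h2)) h0

theorem sum_sum_eq_zero_of_antisymm {ι : Type*} [Fintype ι] {T : ι → ι → ℝ}
    (hT : ∀ i j, T j i = -T i j) : ∑ i, ∑ j, T i j = 0 := by
  have h : ∑ i, ∑ j, T i j = -∑ i, ∑ j, T i j := by
    conv_lhs => rw [Finset.sum_comm]
    simp only [← Finset.sum_neg_distrib]
    exact Finset.sum_congr rfl fun i _ => Finset.sum_congr rfl fun j _ => hT i j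
  linarith

/-- Summation by parts; it turns the dissipation of the `p`-th flow into a sum of terms of one sign.
-/
theorem two_mul_sum_mul_sum_of_antisymm {ι : Type*} [Fintype ι] {T : ι → ι → ℝ}
    (hT : ∀ i j, T j i = -T i j) (f : ι → ℝ) :
    2 * ∑ i, f i * ∑ j, T i j = ∑ i, ∑ j, (f i - f j) * T i j := by
  have h : ∑ i, ∑ j, f j * T i j = -∑ i, ∑ j, f i * T i j := by
    rw [Finset.sum_comm, ← Finset.sum_neg_distrib]
    refine Finset.sum_congr rfl fun i _ => ?_
    rw [← Finset.sum_neg_distrib]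
    exact Finset.sum_congr rfl fun j _ => by rw [hT i j, mul_neg]
  simp only [sub_mul, Finset.sum_sub_distrib, h, Finset.mul_sum]
  rw [sub_neg_eq_add, ← two_mul, Finset.mul_sum]
  exact Finset.sum_congr rfl fun i _ => by rw [Finset.mul_sum]

theorem pField_converges_iff [Nontrivial V] (hG : G.Connected) (hg : 6 ≤ G.egirth) {p : ℝ}
    (hp : 1 < p) (r₀ : G.edgeSet → ℝ) :
    ConvergesToConstantCurvature G (pField G p) r₀ ↔
      maxDensity G < (G.edgeFinset.card : ℝ) / (Fintype.card V : ℝ) := by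
  have henergy : ∀ r, 2 * ∑ i, excess G r i * pField G p r i =
      ∑ i, ∑ j, (excess G r i - excess G r j) * pFlux G p r i j := fun r => by
    simp only [pField_apply]
    exact two_mul_sum_mul_sum_of_antisymm (pFlux_antisymm hG hg p r) _
  refine converges_iff hG hg ?_ (fun r => ?_) (fun r => ?_) (fun r hr => ?_) r₀
  · refine continuous_pi fun i => ?_
    simp only [pField_apply]
    refine continuous_finsetSum _ fun j _ => ?_
    unfold pFlux
    split_ifs
    · have hd : Continuous fun r => excess G r j - excess G r i :=
        ((continuous_apply j).comp (continuous_excess hG hg)).sub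
          ((continuous_apply i).comp (continuous_excess hG hg))
      exact (continuous_partialCurvature hG hg i j).neg.mul ((continuous_abs_rpow_mul hp).comp hd)
    · exact continuous_const
  · simp only [pField_apply]
    exact sum_sum_eq_zero_of_antisymm (pFlux_antisymm hG hg p r)
  · have := Finset.sum_nonpos fun i (_ : i ∈ Finset.univ) =>
      Finset.sum_nonpos fun j (_ : j ∈ Finset.univ) => sub_mul_pFlux_nonpos hG hg p r i j
    rw [← henergy] at this
    linarith
  · have h := henergy r
    rw [hr, mul_zero, eq_comm, Finset.sum_eq_zero_iff_of_nonpos fun i _ =>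
      Finset.sum_nonpos fun j _ => sub_mul_pFlux_nonpos hG hg p r i j] at h
    refine eq_of_forall_eq_at_vertex hG fun v k l hk hl => ?_
    by_cases hkl : k = l
    · rw [hkl]
    have hk0 := h k (Finset.mem_univ k)
    rw [Finset.sum_eq_zero_iff_of_nonpos fun j _ => sub_mul_pFlux_nonpos hG hg p r k j] at hk0
    exact eq_of_sub_mul_pFlux_eq_zero hG hg
      (SimpleGraph.lineGraph_adj_iff_exists.2 ⟨hkl, v, hk, hl⟩) (hk0 l (Finset.mem_univ l))

end Modified

/-! ## Powers of positive semidefinite matrices -/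

section SpectralPow

/-- The convention `0 ^ s = 0` gives the exponent law for all real exponents, even when `a + b = 0`.
-/
theorem spectralPow_mul {x : ℝ} (hx : 0 ≤ x) (a b : ℝ) :
    spectralPow a x * spectralPow b x = spectralPow (a + b) x := by
  unfold spectralPow
  split_ifs with h
  · simp
  · rw [Real.rpow_add (lt_of_le_of_ne hx (Ne.symm h))]

theorem spectralPow_one (x : ℝ) : spectralPow 1 x = x := by
  unfold spectralPow
  split_ifs with h
  · exact h.symm
  · exact Real.rpow_one x

/-- For `s ≤ 0` the power is discontinuous at `0`, which does no harm when `0` is isolated from the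
rest of the set. -/
theorem continuousOn_spectralPow (s : ℝ) {T : Set ℝ} (hT : IsClosed T) (hpos : ∀ x ∈ T, 0 < x) :
    ContinuousOn (spectralPow s) ({0} ∪ T) := by
  refine ContinuousOn.union_of_isClosed (continuousOn_singleton _ _) ?_ isClosed_singleton hT
  refine ContinuousOn.congr (f := fun x => x ^ s) ?_ fun x hx => if_neg (hpos x hx).ne'
  exact continuousOn_id.rpow_const fun x hx => Or.inl (hpos x hx).ne'

variable {n : Type*} [Fintype n] [DecidableEq n] {A : Matrix n n ℝ}

theorem exists_eigenvector_of_mem_spectrum {x : ℝ} (hx : x ∈ spectrum ℝ A) :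
    ∃ v : n → ℝ, v ≠ 0 ∧ A.mulVec v = x • v := by
  rw [← Matrix.spectrum_toLin', ← Module.End.hasEigenvalue_iff_mem_spectrum] at hx
  obtain ⟨v, hv⟩ := hx.exists_hasEigenvector
  exact ⟨v, hv.2, by simpa using hv.apply_eq_smul⟩

theorem nonneg_of_mem_spectrum (hA : ∀ f : n → ℝ, 0 ≤ f ⬝ᵥ A.mulVec f) {x : ℝ}
    (hx : x ∈ spectrum ℝ A) : 0 ≤ x := by
  obtain ⟨v, hv, h⟩ := exists_eigenvector_of_mem_spectrum hx
  have h1 := hA v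
  rw [h, dotProduct_smul, smul_eq_mul] at h1
  have h2 : 0 < v ⬝ᵥ v :=
    lt_of_le_of_ne (Finset.sum_nonneg fun i _ => mul_self_nonneg _)
      fun h => hv (dotProduct_self_eq_zero.1 h.symm)
  exact nonneg_of_mul_nonneg_left h1 h2

theorem cfc_spectralPow_mul (hA : ∀ f : n → ℝ, 0 ≤ f ⬝ᵥ A.mulVec f) (a b : ℝ) :
    cfc (spectralPow a) A * cfc (spectralPow b) A = cfc (spectralPow (a + b)) A := by
  have hfin : (spectrum ℝ A).Finite := Matrix.finite_real_spectrum
  rw [← cfc_mul _ _ A (hfin.continuousOn _) (hfin.continuousOn _)]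
  exact cfc_congr fun x hx => spectralPow_mul (nonneg_of_mem_spectrum hA hx) a b

theorem cfc_spectralPow_one (hsym : IsSelfAdjoint A) : cfc (spectralPow 1) A = A := by
  rw [funext spectralPow_one]
  exact cfc_id' ℝ A

theorem dotProduct_cfc_mulVec (f : ℝ → ℝ) (u v : n → ℝ) :
    u ⬝ᵥ (cfc f A).mulVec v = (cfc f A).mulVec u ⬝ᵥ v := by
  have h : IsSelfAdjoint (cfc f A) := cfc_predicate f A
  have h' : (cfc f A).transpose = cfc f A := by
    have := h.star_eq
    rwa [Matrix.star_eq_conjTranspose, Matrix.conjTranspose_eq_transpose_of_trivial] at this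
  rw [Matrix.dotProduct_mulVec, ← Matrix.mulVec_transpose, h']

theorem dotProduct_cfc_spectralPow (hA : ∀ f : n → ℝ, 0 ≤ f ⬝ᵥ A.mulVec f) (s : ℝ) (u : n → ℝ) :
    u ⬝ᵥ (cfc (spectralPow s) A).mulVec u =
      (cfc (spectralPow (s / 2)) A).mulVec u ⬝ᵥ (cfc (spectralPow (s / 2)) A).mulVec u := by
  have h := cfc_spectralPow_mul hA (s / 2) (s / 2)
  rw [add_halves] at h
  rw [← h, ← Matrix.mulVec_mulVec, dotProduct_cfc_mulVec]

/-- The form of the `s`-th power is the squared length of the half power applied to `u`, and `A`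
factors as its power `1 - s / 2` times its power `s / 2`. -/
theorem mulVec_eq_zero_of_dotProduct_cfc (hsym : IsSelfAdjoint A)
    (hA : ∀ f : n → ℝ, 0 ≤ f ⬝ᵥ A.mulVec f) {s : ℝ} {u : n → ℝ}
    (h : u ⬝ᵥ (cfc (spectralPow s) A).mulVec u = 0) : A.mulVec u = 0 := by
  rw [dotProduct_cfc_spectralPow hA, dotProduct_self_eq_zero] at h
  have h1 := cfc_spectralPow_mul hA (1 - s / 2) (s / 2)
  rw [sub_add_cancel, cfc_spectralPow_one hsym] at h1
  rw [← h1, ← Matrix.mulVec_mulVec, h, Matrix.mulVec_zero]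

theorem cfc_spectralPow_mulVec_eq_zero (hsym : IsSelfAdjoint A)
    (hA : ∀ f : n → ℝ, 0 ≤ f ⬝ᵥ A.mulVec f) (s : ℝ) {u : n → ℝ} (h : A.mulVec u = 0) :
    (cfc (spectralPow s) A).mulVec u = 0 := by
  have h1 := cfc_spectralPow_mul hA (s - 1) 1
  rw [sub_add_cancel, cfc_spectralPow_one hsym] at h1
  rw [← h1, ← Matrix.mulVec_mulVec, h, Matrix.mulVec_zero]

open scoped Matrix.Norms.L2Operator in
/-- Powers of a continuous family of positive semidefinite matrices whose kernel consists of the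
constant vectors depend continuously on the parameter. -/
theorem continuous_cfc_spectralPow {X : Type*} [TopologicalSpace X] [LocallyCompactSpace X]
    {A : X → Matrix n n ℝ} (hAc : Continuous A) (hsym : ∀ x, IsSelfAdjoint (A x))
    (hA : ∀ x (f : n → ℝ), 0 ≤ f ⬝ᵥ (A x).mulVec f)
    (hA0 : ∀ x (f : n → ℝ), f ⬝ᵥ (A x).mulVec f = 0 → ∀ i j, f i = f j)
    (hA1 : ∀ x, (A x).mulVec 1 = 0) (s : ℝ) :
    Continuous fun x => cfc (spectralPow s) (A x) := by
  rw [continuous_iff_continuousAt]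
  intro x₀
  obtain ⟨K, hK, hKx⟩ := exists_compact_mem_nhds x₀
  -- Unit vectors orthogonal to the constants, that is, to the kernel. The quadratic form is
  -- positive on them, so over a compact set of parameters its values give a uniform spectral gap.
  set S : Set (n → ℝ) := {v | v ⬝ᵥ v = 1 ∧ 1 ⬝ᵥ v = 0} with hS
  have hSc : IsCompact S := by
    refine Metric.isCompact_of_isClosed_isBounded ?_ ?_
    · exact (isClosed_eq (by fun_prop) continuous_const).inter
        (isClosed_eq (by fun_prop) continuous_const)
    · refine (Metric.isBounded_closedBall (x := (0 : n → ℝ)) (r := 1)).subset fun v hv => ?_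
      rw [mem_closedBall_zero_iff, pi_norm_le_iff_of_nonneg zero_le_one]
      intro i
      have h1 : v i * v i ≤ v ⬝ᵥ v :=
        Finset.single_le_sum (f := fun i => v i * v i) (fun j _ => mul_self_nonneg _)
          (Finset.mem_univ i)
      rw [hv.1] at h1
      rw [Real.norm_eq_abs, abs_le]
      constructor <;> nlinarith
  set Q : X × (n → ℝ) → ℝ := fun p => p.2 ⬝ᵥ (A p.1).mulVec p.2 with hQ
  have hQc : Continuous Q :=
    continuous_snd.dotProduct ((hAc.comp continuous_fst).matrix_mulVec continuous_snd)
  have hT : IsCompact (Q '' (K ×ˢ S)) := (hK.prod hSc).image hQc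
  have hTpos : ∀ y ∈ Q '' (K ×ˢ S), 0 < y := by
    rintro _ ⟨⟨x, v⟩, ⟨-, hv1, hv0⟩, rfl⟩
    refine lt_of_le_of_ne (hA x v) fun h => ?_
    have hconst := hA0 x v h.symm
    have hv : v ⬝ᵥ v = 0 := by
      rw [dotProduct]
      refine Finset.sum_eq_zero fun i _ => ?_
      have h1 : ∑ j, v j = 0 := by simpa [dotProduct] using hv0
      simp only [hconst _ i, Finset.sum_const, Finset.card_univ, nsmul_eq_mul] at h1
      have hn : (Fintype.card n : ℝ) ≠ 0 := by
        have : Nonempty n := ⟨i⟩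
        exact_mod_cast Fintype.card_ne_zero
      rw [(mul_eq_zero.1 h1).resolve_left hn, mul_zero]
    rw [hv1] at hv
    exact one_ne_zero hv
  -- A nonzero eigenvalue has an eigenvector orthogonal to `1`, by symmetry and `hA1`; once
  -- normalised, its value under the form is the eigenvalue.
  have hspec : ∀ x ∈ K, spectrum ℝ (A x) ⊆ {0} ∪ Q '' (K ×ˢ S) := by
    intro x hx y hy
    by_cases hy0 : y = 0
    · exact Or.inl hy0
    obtain ⟨v, hv, h⟩ := exists_eigenvector_of_mem_spectrum hy
    have hvv : 0 < v ⬝ᵥ v :=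
      lt_of_le_of_ne (Finset.sum_nonneg fun i _ => mul_self_nonneg _)
        fun h => hv (dotProduct_self_eq_zero.1 h.symm)
    have hone : 1 ⬝ᵥ v = 0 := by
      have h1 : 1 ⬝ᵥ (A x).mulVec v = (A x).mulVec 1 ⬝ᵥ v := by
        have := (hsym x).star_eq
        rw [Matrix.star_eq_conjTranspose, Matrix.conjTranspose_eq_transpose_of_trivial] at this
        rw [Matrix.dotProduct_mulVec, ← Matrix.mulVec_transpose, this]
      rw [hA1, zero_dotProduct, h, dotProduct_smul, smul_eq_mul] at h1
      exact (mul_eq_zero.1 h1).resolve_left hy0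
    have hsq : √(v ⬝ᵥ v) ≠ 0 := (Real.sqrt_pos.2 hvv).ne'
    have hmul : (√(v ⬝ᵥ v))⁻¹ * ((√(v ⬝ᵥ v))⁻¹ * (v ⬝ᵥ v)) = 1 := by
      rw [← mul_assoc, ← mul_inv, Real.mul_self_sqrt hvv.le, inv_mul_cancel₀ hvv.ne']
    refine Or.inr ⟨(x, (√(v ⬝ᵥ v))⁻¹ • v), ⟨hx, ?_, ?_⟩, ?_⟩
    · rw [smul_dotProduct, dotProduct_smul, smul_eq_mul, smul_eq_mul, hmul]
    · rw [dotProduct_smul, hone, smul_zero]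
    · simp only [hQ]
      rw [Matrix.mulVec_smul, h, smul_dotProduct, dotProduct_smul, dotProduct_smul, smul_eq_mul,
        smul_eq_mul, smul_eq_mul]
      linear_combination y * hmul
  refine ContinuousAt.cfc (isCompact_singleton.union hT) (spectralPow s) hAc.continuousAt ?_
    (Filter.Eventually.of_forall hsym) (continuousOn_spectralPow s hT.isClosed hTpos)
  filter_upwards [hKx] with x hx using hspec x hx

end SpectralPow

/-! ## The fractional Calabi flow -/

section Fractional

variable {V : Type*} [Fintype V] [DecidableEq V] {G : SimpleGraph V} [DecidableRel G.Adj]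

theorem isSelfAdjoint_jacobian (hG : G.Connected) (hg : 6 ≤ G.egirth) (r : G.edgeSet → ℝ) :
    IsSelfAdjoint (jacobian G r) := by
  refine Matrix.IsHermitian.ext fun i j => ?_
  simpa [jacobian] using partialCurvature_comm hG hg r j i

theorem dotProduct_jacobian_mulVec (r f : G.edgeSet → ℝ) :
    f ⬝ᵥ (jacobian G r).mulVec f = ∑ i, f i * ∑ j, partialCurvature G r i j * f j := rfl

theorem jacobian_mulVec_one [Nontrivial V] (hG : G.Connected) (hg : 6 ≤ G.egirth)
    (r : G.edgeSet → ℝ) : (jacobian G r).mulVec 1 = 0 := by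
  funext i
  simpa [jacobian, Matrix.mulVec, dotProduct] using sum_partialCurvature hG hg r i

/-- Every power of the Jacobian inherits positivity and the constant vectors in its kernel; zero
dissipation passes back to the Jacobian itself, whatever the sign of `s`. -/
theorem fractionalField_converges_iff [Nontrivial V] (hG : G.Connected) (hg : 6 ≤ G.egirth)
    (s : ℝ) (r₀ : G.edgeSet → ℝ) :
    ConvergesToConstantCurvature G (fractionalField G s) r₀ ↔
      maxDensity G < (G.edgeFinset.card : ℝ) / (Fintype.card V : ℝ) := by
  have hsym := isSelfAdjoint_jacobian hG hg
  have hnn : ∀ r f : G.edgeSet → ℝ, 0 ≤ f ⬝ᵥ (jacobian G r).mulVec f :=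
    quadraticForm_nonneg hG hg
  have hfield : ∀ r, fractionalField G s r =
      -(cfc (spectralPow s) (jacobian G r)).mulVec (excess G r) := fun r => rfl
  have henergy : ∀ r, ∑ i, excess G r i * fractionalField G s r i =
      -(excess G r ⬝ᵥ (cfc (spectralPow s) (jacobian G r)).mulVec (excess G r)) := fun r => by
    rw [hfield, ← dotProduct_neg]
    rfl
  refine converges_iff hG hg ?_ (fun r => ?_) (fun r => ?_) (fun r hr => ?_) r₀
  · have hJ : Continuous (jacobian G) :=
      continuous_matrix fun i j => continuous_partialCurvature hG hg i j
    have hpow := continuous_cfc_spectralPow hJ hsym hnn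
      (fun r f h => eq_of_quadraticForm_eq_zero hG hg h) (jacobian_mulVec_one hG hg) s
    exact (hpow.matrix_mulVec (continuous_excess hG hg)).neg
  · have h : ∑ i, fractionalField G s r i = 1 ⬝ᵥ fractionalField G s r := by simp [dotProduct]
    rw [h, hfield, dotProduct_neg, dotProduct_cfc_mulVec,
      cfc_spectralPow_mulVec_eq_zero (hsym r) (hnn r) s (jacobian_mulVec_one hG hg r),
      zero_dotProduct, neg_zero]
  · rw [henergy, dotProduct_cfc_spectralPow (hnn r), neg_nonpos]
    exact Finset.sum_nonneg fun i _ => mul_self_nonneg _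
  · rw [henergy, neg_eq_zero] at hr
    refine eq_of_quadraticForm_eq_zero hG hg (r := r) ?_
    rw [← dotProduct_jacobian_mulVec, mulVec_eq_zero_of_dotProduct_cfc (hsym r) (hnn r) hr,
      dotProduct_zero]

end Fractional

end CalabiFlow

end

theorem mainTheorem2 {V : Type*} [Fintype V] [DecidableEq V] [Nontrivial V]
    (G : SimpleGraph V) [DecidableRel G.Adj] (hconn : G.Connected) (hgirth : 6 ≤ G.egirth)
    (r₀ : G.edgeSet → ℝ) :
    (CalabiFlow.ConvergesToConstantCurvature G (CalabiFlow.modifiedField G) r₀ ↔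
      CalabiFlow.maxDensity G < (G.edgeFinset.card : ℝ) / (Fintype.card V : ℝ)) ∧
    (∀ s : ℝ,
      (CalabiFlow.ConvergesToConstantCurvature G (CalabiFlow.fractionalField G s) r₀ ↔
        CalabiFlow.maxDensity G < (G.edgeFinset.card : ℝ) / (Fintype.card V : ℝ))) ∧
    (∀ p : ℝ, 1 < p →
      (CalabiFlow.ConvergesToConstantCurvature G (CalabiFlow.pField G p) r₀ ↔
        CalabiFlow.maxDensity G < (G.edgeFinset.card : ℝ) / (Fintype.card V : ℝ))) :=
  ⟨CalabiFlow.modifiedField_converges_iff hconn hgirth r₀,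
    fun s => CalabiFlow.fractionalField_converges_iff hconn hgirth s r₀,
    fun _ hp => CalabiFlow.pField_converges_iff hconn hgirth hp r₀⟩
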